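/- Let $n\ge 2$, let $f,g$ be positive smooth functions on the unit sphere $\mathbb{S}^{n-1}\subset\mathbb{R}^n$ which are even ($f(-x)=f(x)$, $g(-x)=g(x)$) and satisfy $$\int_{\mathbb{S}^{n-1}} f(x)\,dx=\int_{\mathbb{S}^{n-1}} g(u)\,du .$$ Let $M_0\subset\mathbb{R}^n$ be a smooth, closed, uniformly convex hypersurface (a smoothly embedded sphere bounding a convex body, with all principal curvatures positive) which contains the origin in its interior and is origin-symmetric ($M_0=-M_0$). Then there is a constant $C>0$, depending only on $M_0$, $f$ and $g$ (and $n$), with the following property. Let $0<T\le\infty$ and let $X:\mathbb{S}^{n-1}\times[0,T)\to\mathbb{R}^n$ be a smooth strictly convex solution of the flow $$\frac{\partial X}{\partial t}(x,t)=-\frac{f(\nu)}{g\left(X/|X|\right)}\,|X|^{n}\,\mathcal{K}\,\nu+X,\qquad X(\mathbb{S}^{n-1},0)=M_0,$$ which encloses the origin. That is, for every $t\in[0,T)$ the map $X(\cdot,t)$ is a smooth embedding whose image $M_t=X(\mathbb{S}^{n-1},t)$ is the boundary of a strictly convex body with the origin in its interior; $\nu$ and $\mathcal{K}$ denote the unit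 outer normal and the Gauss curvature of $M_t$ at $X(x,t)$. Then for every $t\in[0,T)$ the support function $h(x,t)=\max_{y\in M_t}\langle y,x\rangle$ and the radial function $\rho(u,t)=\max\{\lambda>0:\lambda u\in M_t\}$ of $M_t$ satisfy $$\frac1C\le h(x,t)\le C\quad\text{for all }x\in\mathbb{S}^{n-1},\qquad \frac1C\le\rho(u,t)\le C\quad\text{for all }u\in\mathbb{S}^{n-1}.$$ -/

import Mathlib

open Set Metric MeasureTheory Topology
open scoped Manifold ContDiff RealInnerProductSpace

noncomputable section

namespace GaussFlow

/-- The Euclidean space `ℝⁿ` with `n = d + 1`. -/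
abbrev Euc (d : ℕ) : Type := EuclideanSpace ℝ (Fin (d + 1))

/-- The unit sphere `𝕊ⁿ⁻¹` of `ℝⁿ`, `n = d + 1`: a smooth manifold of dimension `d = n - 1`. -/
abbrev Sph (d : ℕ) : Type := sphere (0 : Euc d) 1

variable {d : ℕ}

/-- Surface measure of the unit sphere. -/
def sphereMeasure (d : ℕ) : Measure (Sph d) := (volume : Measure (Euc d)).toSphere

/-- The point `y / |y|` of the unit sphere. The value at `y = 0` is irrelevant. -/
def direction (y : Euc d) : Sph d :=
  if hy : y = 0 then ⟨EuclideanSpace.single 0 1, by simp⟩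
  else ⟨‖y‖⁻¹ • y, by simp [norm_smul, hy]⟩

/-- The support function `h(x) = max {⟨y, x⟩ : y ∈ M}` of a (compact, nonempty) set `M`. -/
def supportFn (M : Set (Euc d)) (x : Sph d) : ℝ :=
  sSup ((fun y : Euc d => ⟪y, (x : Euc d)⟫) '' M)

/-- The radial function `ρ(u) = max {r > 0 : r u ∈ M}` of a compact set `M`
which meets every open ray that starts at the origin. -/
def radialFn (M : Set (Euc d)) (u : Sph d) : ℝ :=
  sSup {r : ℝ | 0 < r ∧ r • (u : Euc d) ∈ M}

/-- A smooth embedding of the sphere into `ℝⁿ`: a smooth injective immersion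
(an injective immersion of a compact manifold is a homeomorphism onto its image). -/
structure IsSmoothEmbeddedSphere (X : Sph d → Euc d) : Prop where
  smooth : ContMDiff (𝓡 d) 𝓘(ℝ, Euc d) ∞ X
  injective : Function.Injective X
  immersion : ∀ x, Function.Injective (mfderiv (𝓡 d) 𝓘(ℝ, Euc d) X x)

/-- `M` is the boundary of a convex body (a compact convex set)
that contains the origin in its interior. -/
def BoundsConvexBody (M : Set (Euc d)) : Prop :=
  ∃ K : Set (Euc d), IsCompact K ∧ Convex ℝ K ∧ 0 ∈ interior K ∧ frontier K = M

/-- `M` is the boundary of a strictly convex body (no segments in the boundary)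
that contains the origin in its interior. -/
def BoundsStrictlyConvexBody (M : Set (Euc d)) : Prop :=
  ∃ K : Set (Euc d), IsCompact K ∧ StrictConvex ℝ K ∧ 0 ∈ interior K ∧ frontier K = M

/-- `ν x` is the unit outer normal at `X x` of the convex hypersurface with image `range X`:
a unit vector with `⟨y - X x, ν x⟩ ≤ 0` for all points `y` of the hypersurface. For an
embedding onto the boundary of a convex body it is the unique unit vector that is orthogonal to
the tangent space and points out of the body. -/
def IsOuterNormal (X : Sph d → Euc d) (ν : Sph d → Sph d) : Prop :=
  ∀ x y, ⟪X y - X x, (ν x : Euc d)⟫ ≤ 0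

/-- The vector `∂ᵢ F` at `x`, for the standard basis of the tangent space of the sphere at `x`
(which Mathlib identifies with `ℝᵈ` by the preferred chart at `x`). -/
def partialAt (F : Sph d → Euc d) (x : Sph d) (i : Fin d) : Euc d :=
  mfderiv (𝓡 d) 𝓘(ℝ, Euc d) F x (EuclideanSpace.single i (1 : ℝ) : EuclideanSpace ℝ (Fin d))

/-- The matrix `⟨∂ᵢ X, ∂ⱼ X⟩` of the induced metric. -/
def firstForm (X : Sph d → Euc d) (x : Sph d) : Matrix (Fin d) (Fin d) ℝ :=
  Matrix.of fun i j => ⟪partialAt X x i, partialAt X x j⟫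

/-- The matrix `⟨∂ᵢ ν, ∂ⱼ X⟩` of the second fundamental form with respect to the normal `ν`
(with this sign it is positive for the outer normal of a round sphere). -/
def secondForm (X : Sph d → Euc d) (ν : Sph d → Sph d) (x : Sph d) :
    Matrix (Fin d) (Fin d) ℝ :=
  Matrix.of fun i j => ⟪partialAt (fun z => (ν z : Euc d)) x i, partialAt X x j⟫

/-- The Gauss curvature (the product of the principal curvatures) at `X x` of the hypersurface
`X` with unit normal `ν`. -/
def gaussCurvature (X : Sph d → Euc d) (ν : Sph d → Sph d) (x : Sph d) : ℝ :=
  (secondForm X ν x).det / (firstForm X x).det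

/-- `M` is a smooth, closed, uniformly convex hypersurface of `ℝⁿ` that contains the origin in
its interior and is given by a smooth embedding of the sphere. Uniform convexity is positivity
of all principal curvatures, that is, of the second fundamental form. -/
def IsUniformlyConvexHypersurface (M : Set (Euc d)) : Prop :=
  ∃ (X : Sph d → Euc d) (ν : Sph d → Sph d),
    IsSmoothEmbeddedSphere X ∧ range X = M ∧ BoundsConvexBody M ∧ IsOuterNormal X ν ∧
      ∀ x, (secondForm X ν x).PosDef

/-- The time interval `[0, T)`, where `T = ∞` is allowed. -/
def timeInterval (T : EReal) : Set ℝ := {t : ℝ | 0 ≤ t ∧ (t : EReal) < T}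

/-- `X` is, on `[0, T)`, a smooth strictly convex solution that encloses the origin of the flow
`∂X/∂t = - f(ν) / g(X / |X|) * |X|ⁿ * 𝒦 * ν + X`, where `n = d + 1`, `ν(·, t)` is the unit outer
normal and `𝒦` is the Gauss curvature of `M_t = X(𝕊ⁿ⁻¹, t)`. -/
structure IsStrictlyConvexSolution (f g : Sph d → ℝ) (T : EReal)
    (X : ℝ → Sph d → Euc d) (ν : ℝ → Sph d → Sph d) : Prop where
  smooth : ContMDiffOn ((𝓡 d).prod 𝓘(ℝ, ℝ)) 𝓘(ℝ, Euc d) ∞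
    (fun p : Sph d × ℝ => X p.2 p.1) (univ ×ˢ timeInterval T)
  embedded : ∀ t ∈ timeInterval T, IsSmoothEmbeddedSphere (X t)
  strictlyConvex : ∀ t ∈ timeInterval T, BoundsStrictlyConvexBody (range (X t))
  normal : ∀ t ∈ timeInterval T, IsOuterNormal (X t) (ν t)
  flow : ∀ t ∈ timeInterval T, ∀ x : Sph d,
    HasDerivWithinAt (fun s => X s x)
      (-((f (ν t x) / g (direction (X t x))) * ‖X t x‖ ^ (d + 1) *
          gaussCurvature (X t) (ν t) x) • (ν t x : Euc d) + X t x)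
      (timeInterval T) t

end GaussFlow

end

/-! Write `j` for the gauge of the body `K t` bounded by `M_t`, so that `ρ = 1 / j`, and `N` for the
map from the direction of a boundary point to its outer normal. The Jacobian of `N` is `ρ ^ n * 𝒦 /
h`, so the flow becomes the scalar equation `∂ₜ log j = (f ∘ N) / g * Jac N - 1` on the sphere. No
evolution equation for the support function is needed.

Three facts follow. (a) `∫ g log j` is conserved: its derivative is `∫ (f ∘ N) Jac N - ∫ g = ∫ f - ∫
g = 0` by the change of variables `x = N u` (`IsGaugeFlow.integral_log_gauge_eq`). (b) `∫ f log h`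
does not increase (`IsGaugeFlow.integral_log_bodySupport_le`). With the inverse Gauss map `ψ` of a
fixed time frozen, `⟪ψ x, x⟫ / j (ψ x)` bounds `h x` from below at every time, with equality at the
chosen one. The derivative of the resulting lower barrier has a sign because `∫ (k - g) ^ 2 / g ≥ 0`
for `k = (f ∘ N) Jac N`. (c) Origin symmetry persists, by the maximum principle for `log j (-u) -
log j u` (`IsGaugeFlow.gauge_neg`).

Symmetry gives `|⟪u, x⟫| ≤ h x * j u`, that is `log ρ u + log |⟪u, x⟫| ≤ log h x`. The integral over
the sphere of `-log |⟪x, u⟫|` is bounded uniformly in `u` (`exists_integral_neg_log_inner_le`).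
Integrating the inequality against `f` in `x` and using (b) bounds `ρ` above; integrating it against
`g` in `u` and using (a) bounds `h` below. The other two bounds follow from `max h ≤ max ρ` and `min
h ≤ min ρ`.

All of this is done through `energy = j ^ 2 / 2`. Its gradient is a one-homogeneous bijection of the
punctured space, parallel to the normal. Its Hessian is zero-homogeneous and carries the curvature.
-/

noncomputable section

namespace GaussFlow

set_option linter.unusedSectionVars false

/-! ### Convex bodies through the squared gauge: gradient, Hessian, bijectivity of the gradient. -/

section Body

variable {E : Type*} [NormedAddCommGroup E] [InnerProductSpace ℝ E] [FiniteDimensional ℝ E]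

/-- A compact strictly convex set with the origin in its interior and a `C²` boundary,
expressed by regularity of the gauge. -/
structure IsSmoothBody (K : Set E) : Prop where
  compact : IsCompact K
  strictConvex : StrictConvex ℝ K
  zero_mem : (0 : E) ∈ interior K
  smooth : ContDiffOn ℝ 2 (gauge K) {0}ᶜ

/-- Half of the square of the gauge. -/
def energy (K : Set E) (z : E) : ℝ := gauge K z ^ 2 / 2

/-- The gradient of the energy of `K`. -/
def energyGrad (K : Set E) (z : E) : E := gradient (energy K) z

/-- The Hessian of the energy of `K`. -/
def energyHess (K : Set E) (z : E) : E →L[ℝ] E := fderiv ℝ (energyGrad K) z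

theorem gauge_pos_smul (K : Set E) {c : ℝ} (hc : 0 ≤ c) (z : E) :
    gauge K (c • z) = c * gauge K z := by
  rw [gauge_smul_of_nonneg hc, smul_eq_mul]

theorem gauge_pos_of_ne {K : Set E} (hK : IsCompact K) (h0 : (0 : E) ∈ interior K) {z : E}
    (hz : z ≠ 0) : 0 < gauge K z :=
  (gauge_pos (absorbent_nhds_zero (mem_interior_iff_mem_nhds.1 h0))
    (NormedSpace.isVonNBounded_of_isBounded ℝ hK.isBounded)).2 hz

/-- Restrict to the line through `z` in direction `v` and apply the one-variable second derivative
test. -/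
theorem hessian_nonneg_of_isLocalMin {φ : E → ℝ} {z : E} (hφ : ContDiffAt ℝ 2 φ z)
    (hmin : IsLocalMin φ z) (v : E) : 0 ≤ ⟪fderiv ℝ (gradient φ) z v, v⟫ := by
  set ψ : ℝ → ℝ := fun s => φ (z + s • v) with hψ
  have hline : ∀ s : ℝ, HasDerivAt (fun s : ℝ => z + s • v) v s := fun s => by
    simpa using ((hasDerivAt_id s).smul_const v).const_add z
  have hcl : ContinuousAt (fun s : ℝ => z + s • v) 0 := (hline 0).continuousAt
  have hz0 : z + (0 : ℝ) • v = z := by simp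
  have hdiff : ∀ᶠ y in 𝓝 z, DifferentiableAt ℝ φ y := by
    have h1 := hφ.eventually (by simp)
    filter_upwards [h1] with y hy
    exact hy.differentiableAt (by simp)
  have hgrad : DifferentiableAt ℝ (gradient φ) z := by
    have : DifferentiableAt ℝ (fderiv ℝ φ) z :=
      (hφ.fderiv_right (m := 1) (by norm_num)).differentiableAt (by simp)
    exact ((InnerProductSpace.toDual ℝ E).symm.toContinuousLinearEquiv.differentiableAt).comp z this
  have hev : ∀ᶠ s in 𝓝 (0 : ℝ), deriv ψ s = ⟪gradient φ (z + s • v), v⟫ := by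
    have : ∀ᶠ s in 𝓝 (0 : ℝ), DifferentiableAt ℝ φ (z + s • v) := by
      have := hcl.tendsto
      rw [hz0] at this
      exact this.eventually hdiff
    filter_upwards [this] with s hs
    have h := hs.hasFDerivAt.comp_hasDerivAt s (hline s)
    rw [← inner_gradient_left] at h
    exact h.deriv
  have h2 : HasDerivAt (deriv ψ) ⟪fderiv ℝ (gradient φ) z v, v⟫ 0 := by
    have h3 : HasDerivAt (fun s : ℝ => gradient φ (z + s • v)) (fderiv ℝ (gradient φ) z v) 0 := by
      have : HasFDerivAt (gradient φ) (fderiv ℝ (gradient φ) z) (z + (0 : ℝ) • v) := by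
        rw [hz0]; exact hgrad.hasFDerivAt
      exact this.comp_hasDerivAt 0 (hline 0)
    have h4 := h3.inner ℝ (hasDerivAt_const (0 : ℝ) v)
    simp only [inner_zero_right, zero_add] at h4
    exact h4.congr_of_eventuallyEq hev
  have hminψ : IsLocalMin ψ 0 := by
    have := hcl.tendsto
    rw [hz0] at this
    have h := this.eventually hmin
    filter_upwards [h] with s hs
    simpa [hψ] using hs
  by_contra hneg
  push Not at hneg
  have hcψ : ContinuousAt ψ 0 := by
    have : ContinuousAt φ (z + (0 : ℝ) • v) := by rw [hz0]; exact hφ.continuousAt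
    exact ContinuousAt.comp (f := fun s : ℝ => z + s • v) this hcl
  -- A negative second derivative would make `0` a local maximum as well, so `ψ` would be locally
  -- constant and its second derivative zero.
  have hmax := isLocalMax_of_deriv_deriv_neg (f := ψ) (x₀ := 0) (by rw [h2.deriv]; exact hneg)
    hminψ.deriv_eq_zero hcψ
  have hconst : ψ =ᶠ[𝓝 0] fun _ => ψ 0 := by
    filter_upwards [hmax, hminψ] with s h1 h2 using le_antisymm h1 h2
  have hd : deriv ψ =ᶠ[𝓝 0] fun _ => 0 := by
    filter_upwards [hconst.deriv] with s hs
    simpa using hs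
  have := hd.deriv_eq
  rw [h2.deriv] at this
  simp at this
  linarith

variable {K : Set E}

theorem IsSmoothBody.nhds (hK : IsSmoothBody K) : K ∈ 𝓝 (0 : E) :=
  mem_interior_iff_mem_nhds.1 hK.zero_mem

theorem IsSmoothBody.gauge_pos (hK : IsSmoothBody K) {z : E} (hz : z ≠ 0) : 0 < gauge K z :=
  gauge_pos_of_ne hK.compact hK.zero_mem hz

theorem IsSmoothBody.gauge_add_le (hK : IsSmoothBody K) (y z : E) :
    gauge K (y + z) ≤ gauge K y + gauge K z :=
  _root_.gauge_add_le hK.strictConvex.convex (absorbent_nhds_zero hK.nhds) y z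

theorem IsSmoothBody.contDiffAt_gauge (hK : IsSmoothBody K) {z : E} (hz : z ≠ 0) :
    ContDiffAt ℝ 2 (gauge K) z :=
  hK.smooth.contDiffAt (isOpen_compl_singleton.mem_nhds hz)

theorem IsSmoothBody.contDiffAt_energy (hK : IsSmoothBody K) {z : E} (hz : z ≠ 0) :
    ContDiffAt ℝ 2 (energy K) z :=
  ((hK.contDiffAt_gauge hz).pow 2).div_const 2

theorem IsSmoothBody.hasFDerivAt_energy (hK : IsSmoothBody K) {z : E} (hz : z ≠ 0) :
    HasFDerivAt (energy K) (gauge K z • fderiv ℝ (gauge K) z) z := by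
  have h := ((hK.contDiffAt_gauge hz).differentiableAt (by simp)).hasFDerivAt
  have h2 := (h.pow 2).mul_const (2⁻¹ : ℝ)
  refine h2.congr_fderiv ?_
  ext v
  simp
  ring

theorem IsSmoothBody.inner_energyGrad (hK : IsSmoothBody K) {z : E} (hz : z ≠ 0) (y : E) :
    ⟪energyGrad K z, y⟫ = gauge K z * fderiv ℝ (gauge K) z y := by
  rw [energyGrad, inner_gradient_left, (hK.hasFDerivAt_energy hz).fderiv]
  simp

theorem IsSmoothBody.fderiv_gauge_self (hK : IsSmoothBody K) {z : E} (hz : z ≠ 0) :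
    fderiv ℝ (gauge K) z z = gauge K z := by
  have h := ((hK.contDiffAt_gauge hz).differentiableAt (by simp)).hasFDerivAt
  have hl : HasDerivAt (fun s : ℝ => s • z) z 1 := by
    simpa using (hasDerivAt_id (1 : ℝ)).smul_const z
  have h1 : HasDerivAt (fun s : ℝ => gauge K (s • z)) (fderiv ℝ (gauge K) z z) 1 := by
    have h' : HasFDerivAt (gauge K) (fderiv ℝ (gauge K) z) ((1 : ℝ) • z) := by simpa using h
    exact h'.comp_hasDerivAt 1 hl
  have h2 : HasDerivAt (fun s : ℝ => gauge K (s • z)) (gauge K z) 1 := by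
    have : HasDerivAt (fun s : ℝ => s * gauge K z) (gauge K z) 1 := by
      simpa using (hasDerivAt_id (1 : ℝ)).mul_const (gauge K z)
    refine this.congr_of_eventuallyEq ?_
    filter_upwards [lt_mem_nhds (zero_lt_one' ℝ)] with s hs
    exact gauge_pos_smul K hs.le z
  exact h1.unique h2

/-- Subadditivity bounds the difference quotients of the gauge from the right. -/
theorem IsSmoothBody.fderiv_gauge_le (hK : IsSmoothBody K) {z : E} (hz : z ≠ 0) (y : E) :
    fderiv ℝ (gauge K) z y ≤ gauge K y := by
  have h := ((hK.contDiffAt_gauge hz).differentiableAt (by simp)).hasFDerivAt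
  have hl : HasDerivAt (fun s : ℝ => z + s • y) y 0 := by
    simpa using ((hasDerivAt_id (0 : ℝ)).smul_const y).const_add z
  have h1 : HasDerivAt (fun s : ℝ => gauge K (z + s • y)) (fderiv ℝ (gauge K) z y) 0 := by
    have h' : HasFDerivAt (gauge K) (fderiv ℝ (gauge K) z) (z + (0 : ℝ) • y) := by simpa using h
    exact h'.comp_hasDerivAt 0 hl
  have h2 := (hasDerivWithinAt_iff_tendsto_slope' (s := Ioi (0 : ℝ)) (by simp)).1
    h1.hasDerivWithinAt
  refine le_of_tendsto h2 ?_
  filter_upwards [self_mem_nhdsWithin] with s hs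
  rw [slope_def_field]
  have hs : 0 < s := hs
  rw [div_le_iff₀ (by simpa using hs)]
  have := hK.gauge_add_le z (s • y)
  rw [gauge_pos_smul K hs.le] at this
  simp
  linarith

theorem IsSmoothBody.inner_energyGrad_self (hK : IsSmoothBody K) {z : E} (hz : z ≠ 0) :
    ⟪energyGrad K z, z⟫ = gauge K z ^ 2 := by
  rw [hK.inner_energyGrad hz, hK.fderiv_gauge_self hz, sq]

theorem IsSmoothBody.inner_energyGrad_le (hK : IsSmoothBody K) {z : E} (hz : z ≠ 0) (y : E) :
    ⟪energyGrad K z, y⟫ ≤ gauge K z * gauge K y := by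
  rw [hK.inner_energyGrad hz]
  exact mul_le_mul_of_nonneg_left (hK.fderiv_gauge_le hz y) (gauge_nonneg _)

theorem IsSmoothBody.energyGrad_ne_zero (hK : IsSmoothBody K) {z : E} (hz : z ≠ 0) :
    energyGrad K z ≠ 0 := by
  intro h
  have := hK.inner_energyGrad_self hz
  rw [h, inner_zero_left] at this
  exact (pow_pos (hK.gauge_pos hz) 2).ne this

theorem energy_smul (K : Set E) {c : ℝ} (hc : 0 < c) (z : E) :
    energy K (c • z) = c ^ 2 * energy K z := by
  rw [energy, energy, gauge_pos_smul K hc.le]; ring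

theorem IsSmoothBody.energyGrad_smul (hK : IsSmoothBody K) {c : ℝ} (hc : 0 < c) {z : E}
    (hz : z ≠ 0) : energyGrad K (c • z) = c • energyGrad K z := by
  refine ext_inner_right ℝ fun v => ?_
  have hcz : c • z ≠ 0 := smul_ne_zero hc.ne' hz
  have h1 : HasFDerivAt (fun y => energy K (c • y))
      ((gauge K (c • z) • fderiv ℝ (gauge K) (c • z)).comp (c • ContinuousLinearMap.id ℝ E)) z :=
    HasFDerivAt.comp (f := fun y => c • y) z (hK.hasFDerivAt_energy hcz)
      ((hasFDerivAt_id z).const_smul c)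
  have h2 : HasFDerivAt (fun y => energy K (c • y))
      (c ^ 2 • (gauge K z • fderiv ℝ (gauge K) z)) z := by
    have := (hK.hasFDerivAt_energy hz).const_smul (c ^ 2)
    refine this.congr_of_eventuallyEq (Filter.Eventually.of_forall fun y => ?_)
    simp [energy_smul K hc]
  have := congrArg (fun L : E →L[ℝ] ℝ => L v) (h1.unique h2)
  simp at this
  rw [inner_smul_left, hK.inner_energyGrad hcz, hK.inner_energyGrad hz]
  have h3 : c * (gauge K (c • z) * fderiv ℝ (gauge K) (c • z) v) =
    c * (c * (gauge K z * fderiv ℝ (gauge K) z v)) := by linarith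
  simpa using mul_left_cancel₀ hc.ne' h3

theorem IsSmoothBody.contDiffAt_energyGrad (hK : IsSmoothBody K) {z : E} (hz : z ≠ 0) :
    ContDiffAt ℝ 1 (energyGrad K) z := by
  have := (hK.contDiffAt_energy hz).fderiv_right (m := 1) (by norm_num)
  exact ((InnerProductSpace.toDual ℝ E).symm.toContinuousLinearEquiv.contDiff.contDiffAt).comp z
    this

theorem IsSmoothBody.hasFDerivAt_energyGrad (hK : IsSmoothBody K) {z : E} (hz : z ≠ 0) :
    HasFDerivAt (energyGrad K) (energyHess K z) z :=
  ((hK.contDiffAt_energyGrad hz).differentiableAt (by simp)).hasFDerivAt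

theorem IsSmoothBody.continuousOn_energyHess (hK : IsSmoothBody K) :
    ContinuousOn (energyHess K) {0}ᶜ := fun z hz =>
  (((hK.contDiffAt_energyGrad hz).fderiv_right (m := 0) (by norm_num)).continuousAt
    ).continuousWithinAt

theorem IsSmoothBody.continuousOn_energyGrad (hK : IsSmoothBody K) :
    ContinuousOn (energyGrad K) {0}ᶜ := fun _ hz =>
  (hK.contDiffAt_energyGrad hz).continuousAt.continuousWithinAt

theorem IsSmoothBody.energyHess_smul (hK : IsSmoothBody K) {c : ℝ} (hc : 0 < c) {z : E}
    (hz : z ≠ 0) : energyHess K (c • z) = energyHess K z := by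
  have hcz : c • z ≠ 0 := smul_ne_zero hc.ne' hz
  have h1 : HasFDerivAt (fun y => energyGrad K (c • y))
      ((energyHess K (c • z)).comp (c • ContinuousLinearMap.id ℝ E)) z :=
    HasFDerivAt.comp (f := fun y => c • y) z (hK.hasFDerivAt_energyGrad hcz)
      ((hasFDerivAt_id z).const_smul c)
  have h2 : HasFDerivAt (fun y => energyGrad K (c • y)) (c • energyHess K z) z := by
    refine ((hK.hasFDerivAt_energyGrad hz).const_smul c).congr_of_eventuallyEq ?_
    filter_upwards [isOpen_compl_singleton.mem_nhds hz] with y hy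
    exact hK.energyGrad_smul hc hy
  have := h1.unique h2
  ext v
  have h3 := congrArg (fun L : E →L[ℝ] E => L v) this
  simp only [ContinuousLinearMap.comp_apply, smul_apply,
    ContinuousLinearMap.id_apply, map_smul] at h3
  exact smul_right_injective E hc.ne' h3

theorem IsSmoothBody.energyHess_self (hK : IsSmoothBody K) {z : E} (hz : z ≠ 0) :
    energyHess K z z = energyGrad K z := by
  have hl : HasDerivAt (fun s : ℝ => s • z) z 1 := by
    simpa using (hasDerivAt_id (1 : ℝ)).smul_const z
  have h1 : HasDerivAt (fun s : ℝ => energyGrad K (s • z)) (energyHess K z z) 1 := by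
    have h' : HasFDerivAt (energyGrad K) (energyHess K z) ((1 : ℝ) • z) := by
      simpa using hK.hasFDerivAt_energyGrad hz
    exact h'.comp_hasDerivAt 1 hl
  have h2 : HasDerivAt (fun s : ℝ => energyGrad K (s • z)) (energyGrad K z) 1 := by
    have : HasDerivAt (fun s : ℝ => s • energyGrad K z) (energyGrad K z) 1 := by
      simpa using (hasDerivAt_id (1 : ℝ)).smul_const (energyGrad K z)
    refine this.congr_of_eventuallyEq ?_
    filter_upwards [lt_mem_nhds (zero_lt_one' ℝ)] with s hs
    exact hK.energyGrad_smul hs hz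
  exact h1.unique h2

theorem inner_fderiv_gradient {φ : E → ℝ} {z : E} (hφ : ContDiffAt ℝ 2 φ z) (v w : E) :
    ⟪fderiv ℝ (gradient φ) z v, w⟫ = fderiv ℝ (fderiv ℝ φ) z v w := by
  have h : DifferentiableAt ℝ (fderiv ℝ φ) z :=
    (hφ.fderiv_right (m := 1) (by norm_num)).differentiableAt (by simp)
  have hg : DifferentiableAt ℝ (gradient φ) z :=
    ((InnerProductSpace.toDual ℝ E).symm.toContinuousLinearEquiv.differentiableAt).comp z h
  have h1 := (hg.hasFDerivAt.inner ℝ (hasFDerivAt_const w z))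
  have h2 := h.hasFDerivAt.clm_apply (hasFDerivAt_const w z)
  simp only [inner_gradient_left] at h1
  have h3 := congrArg (fun L : E →L[ℝ] ℝ => L v) (h1.unique h2)
  simpa using h3

theorem IsSmoothBody.energyHess_symm (hK : IsSmoothBody K) {z : E} (hz : z ≠ 0) (v w : E) :
    ⟪energyHess K z v, w⟫ = ⟪v, energyHess K z w⟫ := by
  have h := (hK.contDiffAt_energy hz).isSymmSndFDerivAt (by simp)
  rw [real_inner_comm (energyHess K z w)]
  change ⟪fderiv ℝ (gradient (energy K)) z v, w⟫ = ⟪fderiv ℝ (gradient (energy K)) z w, v⟫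
  rw [inner_fderiv_gradient (hK.contDiffAt_energy hz),
    inner_fderiv_gradient (hK.contDiffAt_energy hz)]
  exact h v w

/-- The energy minus its linear part at `z` has a global minimum at `z`, because `⟪energyGrad K z,
y⟫ ≤ gauge K z * gauge K y` and `2ab ≤ a ^ 2 + b ^ 2`. -/
theorem IsSmoothBody.energyHess_nonneg (hK : IsSmoothBody K) {z : E} (hz : z ≠ 0) (v : E) :
    0 ≤ ⟪energyHess K z v, v⟫ := by
  set V := energyGrad K z
  have hφ : ContDiffAt ℝ 2 (fun y => energy K y - ⟪V, y⟫) z :=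
    (hK.contDiffAt_energy hz).sub (contDiffAt_const.inner ℝ contDiffAt_id)
  have hmin : IsLocalMin (fun y => energy K y - ⟪V, y⟫) z := by
    refine Filter.Eventually.of_forall fun y => ?_
    have h1 := hK.inner_energyGrad_le hz y
    have h2 := hK.inner_energyGrad_self hz
    simp only [energy, V, h2]
    nlinarith [sq_nonneg (gauge K y - gauge K z)]
  have h := hessian_nonneg_of_isLocalMin hφ hmin v
  have hg : gradient (fun y => energy K y - ⟪V, y⟫) =ᶠ[𝓝 z] fun y => energyGrad K y - V := by
    filter_upwards [isOpen_compl_singleton.mem_nhds hz] with y hy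
    have h1 : HasGradientAt (energy K) (energyGrad K y) y :=
      ((hK.contDiffAt_energy hy).differentiableAt (by simp)).hasGradientAt
    refine HasGradientAt.gradient ?_
    rw [hasGradientAt_iff_hasFDerivAt] at h1 ⊢
    rw [map_sub]
    exact h1.sub ((InnerProductSpace.toDual ℝ E V).hasFDerivAt)
  rw [hg.fderiv_eq, fderiv_sub_const] at h
  exact h

/-- Strict convexity enters here: a supporting hyperplane touches the body at a single point. -/
theorem IsSmoothBody.eq_of_inner_energyGrad (hK : IsSmoothBody K) {y z : E} (hz : z ≠ 0)
    (hyz : gauge K y = gauge K z) (h : ⟪energyGrad K z, y⟫ = gauge K z ^ 2) : y = z := by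
  have hr := hK.gauge_pos hz
  set r := gauge K z with hr_def
  by_contra hne
  have hmem : ∀ x, gauge K x = r → r⁻¹ • x ∈ K := by
    intro x hx
    have : gauge K (r⁻¹ • x) ≤ 1 := by
      rw [gauge_pos_smul K (by positivity), hx, inv_mul_cancel₀ hr.ne']
    rwa [gauge_le_one_iff_mem_closure hK.strictConvex.convex hK.nhds,
      hK.compact.isClosed.closure_eq] at this
  have hint := hK.strictConvex (hmem y hyz) (hmem z rfl)
    (fun h => hne (smul_right_injective E (inv_ne_zero hr.ne') h)) (a := 1 / 2) (b := 1 / 2)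
    (by norm_num) (by norm_num) (by norm_num)
  rw [← gauge_lt_one_iff_mem_interior hK.strictConvex.convex hK.nhds] at hint
  -- The midpoint of the two normalised points is interior, so its gauge is below one, while the
  -- linear functional still takes its maximal value there.
  have h1 := hK.inner_energyGrad_le hz ((1 / 2 : ℝ) • r⁻¹ • y + (1 / 2 : ℝ) • r⁻¹ • z)
  rw [inner_add_right, inner_smul_right, inner_smul_right, inner_smul_right, inner_smul_right, h,
    hK.inner_energyGrad_self hz, ← hr_def] at h1
  have h2 : (1 / 2 : ℝ) * (r⁻¹ * r ^ 2) + 1 / 2 * (r⁻¹ * r ^ 2) = r := by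
    field_simp; norm_num
  rw [h2] at h1
  nlinarith

theorem IsSmoothBody.injOn_energyGrad (hK : IsSmoothBody K) : InjOn (energyGrad K) {0}ᶜ := by
  intro z hz y hy h
  have h1 := hK.inner_energyGrad_self hz
  have h2 := hK.inner_energyGrad_self hy
  have h3 := hK.inner_energyGrad_le hz y
  have h4 := hK.inner_energyGrad_le hy z
  rw [h, h2] at h3
  rw [← h, h1] at h4
  have hz' := hK.gauge_pos hz
  have hy' := hK.gauge_pos hy
  have h5 : gauge K y = gauge K z := by
    apply le_antisymm <;> nlinarith
  refine (hK.eq_of_inner_energyGrad hz h5 ?_).symm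
  rw [h, h2, h5]

/-- The function `m * gauge K y - ⟪y, x⟫` is nonnegative and vanishes at `z`, so its derivative
vanishes there. This identifies the gradient with the outer normal divided by the support value. -/
theorem IsSmoothBody.smul_energyGrad_of_support (hK : IsSmoothBody K) {z x : E} {m : ℝ}
    (hz0 : z ≠ 0) (hz1 : gauge K z = 1) (hm : ⟪z, x⟫ = m)
    (hle : ∀ y : E, ⟪y, x⟫ ≤ m * gauge K y) : m • energyGrad K z = x := by
  have hmin : IsLocalMin (fun y => m * gauge K y - ⟪y, x⟫) z := by
    refine Filter.Eventually.of_forall fun y => ?_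
    have := hle y
    simp only [hz1]
    linarith
  have hd : HasFDerivAt (fun y => m * gauge K y - ⟪y, x⟫)
      (m • fderiv ℝ (gauge K) z - (InnerProductSpace.toDual ℝ E x : E →L[ℝ] ℝ)) z := by
    refine (((hK.contDiffAt_gauge hz0).differentiableAt (by simp)).hasFDerivAt.const_mul m).sub ?_
    refine ((InnerProductSpace.toDual ℝ E x).hasFDerivAt).congr_of_eventuallyEq
      (Filter.Eventually.of_forall fun y => ?_)
    simp [real_inner_comm]
  have h0 := hmin.hasFDerivAt_eq_zero hd
  refine ext_inner_right ℝ fun v => ?_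
  rw [inner_smul_left, hK.inner_energyGrad hz0, hz1]
  have := congrArg (fun L : E →L[ℝ] ℝ => L v) h0
  simp at this
  simp
  linarith

/-- A preimage of `x` is `m • z`, where `z` maximises `⟪·, x⟫` on `K` and `m` is the maximum. -/
theorem IsSmoothBody.image_energyGrad (hK : IsSmoothBody K) :
    energyGrad K '' {0}ᶜ = {0}ᶜ := by
  apply Subset.antisymm
  · rintro _ ⟨z, hz, rfl⟩
    exact hK.energyGrad_ne_zero hz
  · intro x hx
    have hx : x ≠ 0 := hx
    obtain ⟨z, hzK, hmax⟩ := hK.compact.exists_isMaxOn ⟨0, interior_subset hK.zero_mem⟩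
      (f := fun y => ⟪y, x⟫) (by fun_prop)
    have hmax : ∀ y ∈ K, ⟪y, x⟫ ≤ ⟪z, x⟫ := fun y hy => hmax hy
    have hmem : ∀ y : E, y ≠ 0 → (gauge K y)⁻¹ • y ∈ K := by
      intro y hy
      have hr := hK.gauge_pos hy
      have : gauge K ((gauge K y)⁻¹ • y) ≤ 1 := by
        rw [gauge_pos_smul K (by positivity), inv_mul_cancel₀ hr.ne']
      rwa [gauge_le_one_iff_mem_closure hK.strictConvex.convex hK.nhds,
        hK.compact.isClosed.closure_eq] at this
    have hm : 0 < ⟪z, x⟫ := by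
      have := hmax _ (hmem x hx)
      rw [inner_smul_left, real_inner_self_eq_norm_sq] at this
      refine lt_of_lt_of_le ?_ this
      have := hK.gauge_pos hx
      have := norm_pos_iff.2 hx
      simp
      positivity
    set m := ⟪z, x⟫ with hm_def
    have hz0 : z ≠ 0 := by
      rintro rfl
      simp [hm_def] at hm
    have hle : ∀ y : E, ⟪y, x⟫ ≤ m * gauge K y := by
      intro y
      by_cases hy : y = 0
      · simp [hy, gauge_zero]
      have h := hmax _ (hmem y hy)
      have hr := hK.gauge_pos hy
      rw [inner_smul_left] at h
      simp only [conj_trivial] at h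
      rwa [inv_mul_le_iff₀ hr, mul_comm] at h
    have hz1 : gauge K z = 1 := by
      have h1 : gauge K z ≤ 1 := gauge_le_one_of_mem hzK
      have h2 := hle z
      nlinarith
    refine ⟨m • z, smul_ne_zero hm.ne' hz0, ?_⟩
    rw [hK.energyGrad_smul hm hz0]
    exact hK.smul_energyGrad_of_support hz0 hz1 rfl hle

end Body

/-! ### Monotonicity of the determinant on positive semidefinite operators. -/

section Determinant

open Matrix in
theorem one_le_det_one_add {n : Type*} [Fintype n] [DecidableEq n] {D : Matrix n n ℝ}
    (hD : D.PosSemidef) : 1 ≤ (1 + D).det := by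
  have h := congrArg (Polynomial.eval (-1 : ℝ)) hD.isHermitian.charpoly_eq
  rw [Matrix.eval_charpoly, Polynomial.eval_prod] at h
  have h1 : (Matrix.scalar n (-1 : ℝ)) - D = -(1 + D) := by
    rw [Matrix.scalar_apply, ← Matrix.diagonal_one, neg_add, Matrix.diagonal_neg, sub_eq_add_neg]
  rw [h1, Matrix.det_neg] at h
  have h2 : ∏ i, Polynomial.eval (-1 : ℝ) (Polynomial.X - Polynomial.C (hD.isHermitian.eigenvalues i))
      = (-1) ^ Fintype.card n * ∏ i, (1 + hD.isHermitian.eigenvalues i) := by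
    rw [Fintype.card, ← Finset.prod_const, ← Finset.prod_mul_distrib]
    refine Finset.prod_congr rfl fun i _ => ?_
    simp
    ring
  rw [show (∏ i, Polynomial.eval (-1 : ℝ) (Polynomial.X - Polynomial.C
    (RCLike.ofReal (hD.isHermitian.eigenvalues i)))) = _ from h2] at h
  rw [mul_left_cancel₀ (pow_ne_zero _ (by norm_num)) h]
  calc (1 : ℝ) = ∏ _i : n, 1 := by simp
    _ ≤ _ := Finset.prod_le_prod (fun i _ => zero_le_one) fun i _ =>
      le_add_of_nonneg_right (hD.eigenvalues_nonneg i)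

-- For invertible `B = Cᴴ C` one has `A = Cᴴ (1 + D) C` with `D = C⁻ᴴ (A - B) C⁻¹` positive
-- semidefinite, and `det (1 + D) ≥ 1`. If `B` is singular the claim is `0 ≤ det A`.
open scoped MatrixOrder ComplexOrder in
theorem det_le_det_of_posSemidef {n : Type*} [Fintype n] [DecidableEq n] {A B : Matrix n n ℝ}
    (hB : B.PosSemidef) (hA : A.PosSemidef) (hAB : (A - B).PosSemidef) : B.det ≤ A.det := by
  by_cases h0 : B.det = 0
  · rw [h0]; exact hA.det_nonneg
  obtain ⟨C, hC⟩ := CStarAlgebra.nonneg_iff_eq_star_mul_self.mp hB.nonneg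
  have hdet : B.det = C.det * C.det := by
    rw [hC, Matrix.det_mul, Matrix.star_eq_conjTranspose, Matrix.det_conjTranspose]
    simp
  have hCu : IsUnit C.det := by
    rw [isUnit_iff_ne_zero]
    rintro h
    exact h0 (by rw [hdet, h, zero_mul])
  have hD := hAB.conjTranspose_mul_mul_same C⁻¹
  have h1 : A = C.conjTranspose * (1 + C⁻¹.conjTranspose * (A - B) * C⁻¹) * C := by
    have h2 : C.conjTranspose * C⁻¹.conjTranspose = 1 := by
      rw [← Matrix.conjTranspose_mul, Matrix.nonsing_inv_mul _ hCu, Matrix.conjTranspose_one]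
    have h3 : C⁻¹ * C = 1 := Matrix.nonsing_inv_mul _ hCu
    rw [Matrix.mul_add, Matrix.add_mul, Matrix.mul_one]
    have h4 : C.conjTranspose * (C⁻¹.conjTranspose * (A - B) * C⁻¹) * C =
      (C.conjTranspose * C⁻¹.conjTranspose) * (A - B) * (C⁻¹ * C) := by
      simp only [Matrix.mul_assoc]
    rw [h4, h2, h3, Matrix.one_mul, Matrix.mul_one, ← Matrix.star_eq_conjTranspose, ← hC]
    abel
  have h5 : A.det = B.det * (1 + C⁻¹.conjTranspose * (A - B) * C⁻¹).det := by
    conv_lhs => rw [h1]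
    rw [Matrix.det_mul, Matrix.det_mul, Matrix.det_conjTranspose, hdet]
    simp
    ring
  rw [h5]
  exact le_mul_of_one_le_right hB.det_nonneg (one_le_det_one_add hD)

variable {E : Type*} [NormedAddCommGroup E] [InnerProductSpace ℝ E] [FiniteDimensional ℝ E]

theorem isPositive_of_inner {A : E →L[ℝ] E} (hs : ∀ v w, ⟪A v, w⟫ = ⟪v, A w⟫)
    (hp : ∀ v, 0 ≤ ⟪A v, v⟫) : (A : E →ₗ[ℝ] E).IsPositive :=
  ⟨hs, fun v => by simpa using hp v⟩

theorem det_nonneg_of_inner {A : E →L[ℝ] E} (hs : ∀ v w, ⟪A v, w⟫ = ⟪v, A w⟫)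
    (hp : ∀ v, 0 ≤ ⟪A v, v⟫) : 0 ≤ A.det := by
  have h := (LinearMap.posSemidef_toMatrix_iff (stdOrthonormalBasis ℝ E)).2
    (isPositive_of_inner hs hp)
  rw [ContinuousLinearMap.det, ← LinearMap.det_toMatrix (stdOrthonormalBasis ℝ E).toBasis]
  exact h.det_nonneg

theorem det_le_det_of_inner {A B : E →L[ℝ] E} (hsA : ∀ v w, ⟪A v, w⟫ = ⟪v, A w⟫)
    (hsB : ∀ v w, ⟪B v, w⟫ = ⟪v, B w⟫) (hpB : ∀ v, 0 ≤ ⟪B v, v⟫)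
    (hAB : ∀ v, ⟪B v, v⟫ ≤ ⟪A v, v⟫) : B.det ≤ A.det := by
  set b := stdOrthonormalBasis ℝ E
  have hB := (LinearMap.posSemidef_toMatrix_iff b).2 (isPositive_of_inner hsB hpB)
  have hA := (LinearMap.posSemidef_toMatrix_iff b).2
    (isPositive_of_inner hsA fun v => (hpB v).trans (hAB v))
  have hAB' := (LinearMap.posSemidef_toMatrix_iff b).2
    (isPositive_of_inner (A := A - B)
      (fun v w => by simp only [sub_apply, inner_sub_left, inner_sub_right, hsA, hsB])
      (fun v => by simp only [sub_apply, inner_sub_left]; linarith [hAB v]))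
  rw [ContinuousLinearMap.det, ContinuousLinearMap.det, ← LinearMap.det_toMatrix b.toBasis,
    ← LinearMap.det_toMatrix b.toBasis]
  refine det_le_det_of_posSemidef hB hA ?_
  rw [← map_sub]
  exact hAB'

end Determinant

/-! ### Directions and polar coordinates. -/

section Sphere

variable {d : ℕ}

theorem coe_direction {y : Euc d} (hy : y ≠ 0) : (direction y : Euc d) = ‖y‖⁻¹ • y := by
  rw [direction, dif_neg hy]

theorem norm_smul_direction {y : Euc d} (hy : y ≠ 0) : ‖y‖ • (direction y : Euc d) = y := by
  rw [coe_direction hy, smul_inv_smul₀ (norm_ne_zero_iff.2 hy)]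

theorem direction_smul {c : ℝ} (hc : 0 < c) {y : Euc d} (hy : y ≠ 0) :
    direction (c • y) = direction y := by
  apply Subtype.ext
  rw [coe_direction hy, coe_direction (smul_ne_zero hc.ne' hy), norm_smul, smul_smul,
    Real.norm_of_nonneg hc.le, mul_inv, mul_comm c⁻¹, mul_assoc, inv_mul_cancel₀ hc.ne', mul_one]

theorem sphere_ne_zero (u : Sph d) : (u : Euc d) ≠ 0 := ne_zero_of_mem_unit_sphere u

theorem norm_sphere (u : Sph d) : ‖(u : Euc d)‖ = 1 := norm_eq_of_mem_sphere u

theorem direction_coe (u : Sph d) : direction (u : Euc d) = u := by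
  apply Subtype.ext
  rw [coe_direction (sphere_ne_zero u), norm_sphere]
  simp

theorem direction_smul_coe {c : ℝ} (hc : 0 < c) (u : Sph d) :
    direction (c • (u : Euc d)) = u := by
  rw [direction_smul hc (sphere_ne_zero u), direction_coe]

theorem direction_neg {y : Euc d} (hy : y ≠ 0) : direction (-y) = -direction y := by
  apply Subtype.ext
  rw [coe_direction (neg_ne_zero.2 hy)]
  simp [coe_direction hy]

theorem continuousOn_direction : ContinuousOn (direction : Euc d → Sph d) {0}ᶜ := by
  rw [Topology.IsInducing.subtypeVal.continuousOn_iff]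
  have : ContinuousOn (fun y : Euc d => ‖y‖⁻¹ • y) {0}ᶜ :=
    (continuous_norm.continuousOn.inv₀ fun y hy => norm_ne_zero_iff.2 hy).smul continuousOn_id
  exact this.congr fun y hy => coe_direction hy

theorem measurable_direction : Measurable (direction : Euc d → Sph d) :=
  measurable_of_continuousOn_compl_singleton 0 continuousOn_direction

instance : IsFiniteMeasure (sphereMeasure d) := by
  unfold sphereMeasure; infer_instance

theorem sphereMeasure_ne_zero : sphereMeasure d ≠ 0 := Measure.toSphere_ne_zero _

theorem measurable_smul_coe : Measurable fun p : Sph d × Ioi (0 : ℝ) => (p.2 : ℝ) • (p.1 : Euc d) := by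
  fun_prop

theorem lintegral_polar {H : Euc d → ENNReal} (hH : Measurable H) :
    ∫⁻ y, H y = ∫⁻ u, ∫⁻ r : Ioi (0 : ℝ), H ((r : ℝ) • (u : Euc d))
      ∂(Measure.volumeIoiPow d) ∂(sphereMeasure d) := by
  have h := (volume : Measure (Euc d)).measurePreserving_homeomorphUnitSphereProd
  have hd : Module.finrank ℝ (Euc d) - 1 = d := by simp
  rw [hd] at h
  have h1 : ∫⁻ y, H y = ∫⁻ y in ({0}ᶜ : Set (Euc d)), H y := by
    rw [setLIntegral_congr (t := univ) , setLIntegral_univ]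
    exact (ae_eq_univ.2 (by simp))
  rw [h1, ← lintegral_subtype_comap (measurableSet_singleton _).compl]
  have h2 : ∀ y : ({0}ᶜ : Set (Euc d)), H y =
      (fun p : Sph d × Ioi (0 : ℝ) => H ((p.2 : ℝ) • (p.1 : Euc d)))
        (homeomorphUnitSphereProd (Euc d) y) := by
    intro y
    have := congrArg Subtype.val ((homeomorphUnitSphereProd (Euc d)).symm_apply_apply y)
    simp only
    conv_lhs => rw [← this]
    rfl
  simp_rw [h2]
  rw [h.lintegral_comp (f := fun p : Sph d × Ioi (0 : ℝ) => H ((p.2 : ℝ) • (p.1 : Euc d)))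
    (hH.comp measurable_smul_coe)]
  rw [sphereMeasure, lintegral_prod (fun p : Sph d × Ioi (0 : ℝ) => H ((p.2 : ℝ) • (p.1 : Euc d)))
      (hH.comp measurable_smul_coe).aemeasurable]

end Sphere

/-! ### The Gauss map as a homeomorphism of the sphere, and its change of variables. -/

section GaussMap

variable {d : ℕ} {K : Set (Euc d)}

/-- The Gauss map of a convex body in terms of the direction of the boundary point. -/
def normalMap (K : Set (Euc d)) (u : Sph d) : Sph d := direction (energyGrad K u)

/-- The Jacobian of the Gauss map `normalMap K`. -/
def normalJacobian (K : Set (Euc d)) (u : Sph d) : ℝ :=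
  (energyHess K u).det / ‖energyGrad K u‖ ^ (d + 1)

theorem IsSmoothBody.continuous_normalMap (hK : IsSmoothBody K) : Continuous (normalMap K) := by
  refine continuousOn_direction.comp_continuous
    (hK.continuousOn_energyGrad.comp_continuous continuous_subtype_val fun u => ?_) fun u => ?_
  · exact sphere_ne_zero u
  · exact hK.energyGrad_ne_zero (sphere_ne_zero u)

theorem IsSmoothBody.continuous_normalJacobian (hK : IsSmoothBody K) :
    Continuous (normalJacobian K) := by
  have h1 : Continuous fun u : Sph d => energyHess K u :=
    hK.continuousOn_energyHess.comp_continuous continuous_subtype_val sphere_ne_zero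
  have h2 : Continuous fun u : Sph d => energyGrad K u :=
    hK.continuousOn_energyGrad.comp_continuous continuous_subtype_val sphere_ne_zero
  refine (ContinuousLinearMap.continuous_det.comp h1).div (h2.norm.pow _) fun u => ?_
  exact pow_ne_zero _ (norm_ne_zero_iff.2 (hK.energyGrad_ne_zero (sphere_ne_zero u)))

theorem IsSmoothBody.det_energyHess_nonneg (hK : IsSmoothBody K) {z : Euc d} (hz : z ≠ 0) :
    0 ≤ (energyHess K z).det :=
  det_nonneg_of_inner (hK.energyHess_symm hz) (hK.energyHess_nonneg hz)

theorem IsSmoothBody.normalJacobian_nonneg (hK : IsSmoothBody K) (u : Sph d) :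
    0 ≤ normalJacobian K u :=
  div_nonneg (hK.det_energyHess_nonneg (sphere_ne_zero u)) (by positivity)

theorem IsSmoothBody.bijective_normalMap (hK : IsSmoothBody K) :
    Function.Bijective (normalMap K) := by
  constructor
  · intro u v h
    have hu := hK.energyGrad_ne_zero (sphere_ne_zero u)
    have hv := hK.energyGrad_ne_zero (sphere_ne_zero v)
    have hu' := norm_pos_iff.2 hu
    have hv' := norm_pos_iff.2 hv
    have h1 := congrArg Subtype.val h
    simp only [normalMap] at h1
    rw [coe_direction hu, coe_direction hv, ← hK.energyGrad_smul (by positivity) (sphere_ne_zero u),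
      ← hK.energyGrad_smul (by positivity) (sphere_ne_zero v)] at h1
    have h2 := hK.injOn_energyGrad (smul_ne_zero (inv_ne_zero hu'.ne') (sphere_ne_zero u))
      (smul_ne_zero (inv_ne_zero hv'.ne') (sphere_ne_zero v)) h1
    have h3 := congrArg direction h2
    rwa [direction_smul_coe (by positivity), direction_smul_coe (by positivity)] at h3
  · intro x
    have hx : (x : Euc d) ∈ energyGrad K '' {0}ᶜ := by
      rw [hK.image_energyGrad]; exact sphere_ne_zero x
    obtain ⟨z, hz, hzx⟩ := hx
    have hz : z ≠ 0 := hz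
    refine ⟨direction z, ?_⟩
    rw [normalMap, coe_direction hz, hK.energyGrad_smul (by positivity) hz, hzx,
      direction_smul_coe (by positivity)]

/-- The Gauss map of a body as a homeomorphism of the sphere. -/
def normalHomeo (hK : IsSmoothBody K) : Sph d ≃ₜ Sph d :=
  Continuous.homeoOfEquivCompactToT2 (f := Equiv.ofBijective _ hK.bijective_normalMap)
    hK.continuous_normalMap

theorem lintegral_indicator_radial (c : ENNReal) {a : ℝ} (ha : 0 < a) :
    ∫⁻ r : Ioi (0 : ℝ), (if (r : ℝ) * a < 1 then c else 0) ∂(Measure.volumeIoiPow d) =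
      c * ENNReal.ofReal ((a ^ (d + 1))⁻¹ / (d + 1)) := by
  have h : ∀ r : Ioi (0 : ℝ), (if (r : ℝ) * a < 1 then c else 0) =
      (Iio (⟨a⁻¹, inv_pos.2 ha⟩ : Ioi (0 : ℝ))).indicator (fun _ => c) r := by
    intro r
    have : (r : ℝ) * a < 1 ↔ r ∈ Iio (⟨a⁻¹, inv_pos.2 ha⟩ : Ioi (0 : ℝ)) := by
      rw [mem_Iio, ← Subtype.coe_lt_coe, ← lt_inv_mul_iff₀' ha]
      simp
    simp [indicator, this]
  simp_rw [h]
  rw [lintegral_indicator measurableSet_Iio, setLIntegral_const, Measure.volumeIoiPow_apply_Iio]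
  simp

/-- The change of variables is made in the full space, with the injective map `energyGrad K`, and
then read in polar coordinates. By homogeneity the radial integral over `r * ‖energyGrad K u‖ < 1`
produces the power in the denominator of `normalJacobian`. -/
theorem IsSmoothBody.lintegral_normalMap (hK : IsSmoothBody K) {F : Sph d → ENNReal}
    (hF : Measurable F) :
    ∫⁻ u, F (normalMap K u) * ENNReal.ofReal (normalJacobian K u) ∂(sphereMeasure d) =
      ∫⁻ x, F x ∂(sphereMeasure d) := by
  classical
  -- The zero-homogeneous extension of `F`, cut off to the unit ball so that its radial integral is
  -- the finite constant `1 / (d + 1)`.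
  set H : Euc d → ENNReal := fun y => if ‖y‖ < 1 then F (direction y) else 0 with hH
  have hHm : Measurable H :=
    Measurable.ite (measurableSet_lt measurable_norm measurable_const)
      (hF.comp measurable_direction) measurable_const
  have h1 : ∫⁻ y, H y = (∫⁻ x, F x ∂(sphereMeasure d)) * ENNReal.ofReal ((d + 1 : ℝ)⁻¹) := by
    rw [lintegral_polar hHm, ← lintegral_mul_const _ hF]
    refine lintegral_congr fun u => ?_
    have := lintegral_indicator_radial (d := d) (F u) one_pos
    simp only [one_pow, inv_one, one_div] at this
    rw [← this]
    refine lintegral_congr fun r => ?_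
    have hr : (0 : ℝ) < r := r.2
    simp only [hH, norm_smul, norm_sphere, direction_smul_coe hr, Real.norm_of_nonneg hr.le]
  set s : Set (Euc d) := {0}ᶜ with hs
  have hsm : MeasurableSet s := (measurableSet_singleton _).compl
  have hns : ∀ G : Euc d → ENNReal, ∫⁻ y in s, G y = ∫⁻ y, G y := by
    intro G
    rw [setLIntegral_congr (t := univ) , setLIntegral_univ]
    exact (ae_eq_univ.2 (by simp [hs]))
  have h2 := lintegral_image_eq_lintegral_abs_det_fderiv_mul volume hsm
    (fun z hz => (hK.hasFDerivAt_energyGrad hz).hasFDerivWithinAt) hK.injOn_energyGrad H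
  rw [hK.image_energyGrad, ← hs, hns, h1] at h2
  set Q : Euc d → ENNReal := fun z =>
    s.indicator (fun z => ENNReal.ofReal |(energyHess K z).det| * H (energyGrad K z)) z with hQ
  have hVm : Measurable (s.indicator (energyGrad K)) :=
    measurable_of_continuousOn_compl_singleton 0
      (hK.continuousOn_energyGrad.congr fun z hz => indicator_of_mem hz _)
  have hWm : Measurable (s.indicator (energyHess K)) :=
    measurable_of_continuousOn_compl_singleton 0
      (hK.continuousOn_energyHess.congr fun z hz => indicator_of_mem hz _)
  have hQm : Measurable Q := by
    have : Q = s.indicator (fun z => ENNReal.ofReal |(s.indicator (energyHess K) z).det| *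
        H (s.indicator (energyGrad K) z)) := by
      ext z
      by_cases hz : z ∈ s
      · simp [hQ, hz]
      · simp [hQ, hz]
    rw [this]
    refine Measurable.indicator ?_ hsm
    refine Measurable.mul ?_ (hHm.comp hVm)
    exact ENNReal.measurable_ofReal.comp
      ((continuous_abs.comp ContinuousLinearMap.continuous_det).measurable.comp hWm)
  rw [← lintegral_indicator hsm] at h2
  change _ = ∫⁻ z, Q z at h2
  rw [lintegral_polar hQm] at h2
  have h3 : ∀ u : Sph d, ∫⁻ r : Ioi (0 : ℝ), Q ((r : ℝ) • (u : Euc d)) ∂(Measure.volumeIoiPow d) =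
      F (normalMap K u) * ENNReal.ofReal (normalJacobian K u) * ENNReal.ofReal ((d + 1 : ℝ)⁻¹) := by
    intro u
    have hu := sphere_ne_zero u
    have hV := hK.energyGrad_ne_zero hu
    have hVp := norm_pos_iff.2 hV
    have h4 := lintegral_indicator_radial (d := d)
      (ENNReal.ofReal |(energyHess K u).det| * F (normalMap K u)) hVp
    have h5 : ∀ r : Ioi (0 : ℝ), Q ((r : ℝ) • (u : Euc d)) =
        if (r : ℝ) * ‖energyGrad K u‖ < 1 then
          ENNReal.ofReal |(energyHess K u).det| * F (normalMap K u) else 0 := by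
      intro r
      have hr : (0 : ℝ) < r := r.2
      have hru : (r : ℝ) • (u : Euc d) ∈ s := smul_ne_zero hr.ne' hu
      simp only [hQ, indicator_of_mem hru, hK.energyHess_smul hr hu, hK.energyGrad_smul hr hu, hH,
        norm_smul, Real.norm_of_nonneg hr.le, direction_smul hr hV, mul_ite, mul_zero, normalMap]
    simp_rw [h5]
    rw [h4, abs_of_nonneg (hK.det_energyHess_nonneg hu), normalJacobian, mul_comm
      (ENNReal.ofReal _) (F _), mul_assoc, mul_assoc,
      ← ENNReal.ofReal_mul (hK.det_energyHess_nonneg hu), ← ENNReal.ofReal_mul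
      (div_nonneg (hK.det_energyHess_nonneg hu) (by positivity))]
    congr 2
    field_simp
  simp_rw [h3] at h2
  rw [lintegral_mul_const'] at h2
  · have hne : ENNReal.ofReal ((d + 1 : ℝ)⁻¹) ≠ 0 := by
      simp; positivity
    exact ((ENNReal.mul_left_inj hne ENNReal.ofReal_ne_top).1 h2).symm
  · exact ENNReal.ofReal_ne_top

/-- The nonnegative case says that `normalMap K` pushes the measure with density `normalJacobian K`
to the sphere measure; this gives the formula for real integrands. -/
theorem IsSmoothBody.integral_normalMap (hK : IsSmoothBody K) {F : Sph d → ℝ}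
    (hF : Continuous F) :
    ∫ u, normalJacobian K u * F (normalMap K u) ∂(sphereMeasure d) =
      ∫ x, F x ∂(sphereMeasure d) := by
  have hmap : Measure.map (normalMap K) ((sphereMeasure d).withDensity
      fun u => ENNReal.ofReal (normalJacobian K u)) = sphereMeasure d := by
    ext s hs
    rw [Measure.map_apply hK.continuous_normalMap.measurable hs]
    have h := hK.lintegral_normalMap (F := s.indicator fun _ => 1) (measurable_const.indicator hs)
    rw [lintegral_indicator hs, setLIntegral_const, one_mul] at h
    rw [← h, withDensity_apply _ (hK.continuous_normalMap.measurable hs),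
      ← lintegral_indicator (hK.continuous_normalMap.measurable hs)]
    refine lintegral_congr fun u => ?_
    by_cases hu : normalMap K u ∈ s
    · simp [hu, indicator]
    · simp [hu, indicator]
  conv_rhs => rw [← hmap]
  rw [integral_map hK.continuous_normalMap.measurable.aemeasurable
    hF.aestronglyMeasurable]
  have hm : Measurable fun u => (normalJacobian K u).toNNReal :=
    hK.continuous_normalJacobian.measurable.real_toNNReal
  have := integral_withDensity_eq_integral_smul (μ := sphereMeasure d) hm
    (fun u => F (normalMap K u))
  rw [show (fun u => ENNReal.ofReal (normalJacobian K u)) =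
    fun u => ((normalJacobian K u).toNNReal : ENNReal) from rfl, this]
  refine integral_congr_ae (Filter.Eventually.of_forall fun u => ?_)
  simp only [NNReal.smul_def, smul_eq_mul, Real.coe_toNNReal _ (hK.normalJacobian_nonneg u)]

end GaussMap

/-! ### Differential calculus between the sphere and the ambient space. -/

section SphereCalculus

variable {d : ℕ}

theorem contMDiffAt_direction {y : Euc d} (hy : y ≠ 0) :
    ContMDiffAt 𝓘(ℝ, Euc d) (𝓡 d) ∞ (direction : Euc d → Sph d) y := by
  have : Fact (Module.finrank ℝ (Euc d) = d + 1) := ⟨finrank_euclideanSpace_fin⟩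
  rw [contMDiffAt_iff_target]
  refine ⟨continuousOn_direction.continuousAt (isOpen_compl_singleton.mem_nhds hy), ?_⟩
  rw [contMDiffAt_iff_contDiffAt]
  set v : Sph d := direction y with hv
  let U := (OrthonormalBasis.fromOrthogonalSpanSingleton (𝕜 := ℝ)
        d (ne_zero_of_mem_unit_sphere (-v))).repr
  have h1 : ContDiffAt ℝ ∞ (fun z : Euc d => ‖z‖⁻¹ • z) y :=
    ((contDiffAt_norm ℝ hy).inv (norm_ne_zero_iff.2 hy)).smul contDiffAt_id
  have hval : ‖y‖⁻¹ • y = (v : Euc d) := (coe_direction hy).symm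
  have h2 : ContDiffAt ℝ ∞ (stereoToFun ((-v : Sph d) : Euc d)) (‖y‖⁻¹ • y) := by
    rw [hval]
    refine (contDiffOn_stereoToFun (n := ω)).of_le (by simp) |>.contDiffAt ?_
    refine IsOpen.mem_nhds ?_ ?_
    · exact isOpen_ne_fun (by fun_prop) continuous_const
    · simp
      norm_num
  have h3 : ContDiffAt ℝ ∞
      (fun z : Euc d => U (stereoToFun ((-v : Sph d) : Euc d) (‖z‖⁻¹ • z))) y :=
    U.contDiff.contDiffAt.comp y
      (ContDiffAt.comp (f := fun z : Euc d => ‖z‖⁻¹ • z) y h2 h1)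
  refine h3.congr_of_eventuallyEq ?_
  filter_upwards [isOpen_compl_singleton.mem_nhds hy] with z hz
  simp only [Function.comp_apply, ← coe_direction hz]
  rfl

theorem mdifferentiableAt_coe (u : Sph d) :
    MDifferentiableAt (𝓡 d) 𝓘(ℝ, Euc d) ((↑) : Sph d → Euc d) u := by
  have : Fact (Module.finrank ℝ (Euc d) = d + 1) := ⟨finrank_euclideanSpace_fin⟩
  exact (contMDiff_coe_sphere (m := 1) u).mdifferentiableAt (by simp)

theorem mfderiv_comp_apply {F : Type*} [NormedAddCommGroup F] [NormedSpace ℝ F]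
    {X : Sph d → Euc d} {G : Euc d → F} {p : Sph d}
    (hX : MDifferentiableAt (𝓡 d) 𝓘(ℝ, Euc d) X p) (hG : DifferentiableAt ℝ G (X p))
    (a : EuclideanSpace ℝ (Fin d)) :
    (mfderiv (𝓡 d) 𝓘(ℝ, F) (fun q => G (X q)) p : EuclideanSpace ℝ (Fin d) → F) a =
      fderiv ℝ G (X p) ((mfderiv (𝓡 d) 𝓘(ℝ, Euc d) X p : EuclideanSpace ℝ (Fin d) → Euc d) a) := by
  have h := mfderiv_comp p (hG.mdifferentiableAt) hX
  rw [mfderiv_eq_fderiv] at h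
  change (mfderiv (𝓡 d) 𝓘(ℝ, F) (G ∘ X) p : EuclideanSpace ℝ (Fin d) → F) a = _
  rw [h]
  rfl

theorem exists_mfderiv_coe_eq (u : Sph d) {w : Euc d} (hw : ⟪(u : Euc d), w⟫ = 0) :
    ∃ a : EuclideanSpace ℝ (Fin d),
      (mfderiv (𝓡 d) 𝓘(ℝ, Euc d) ((↑) : Sph d → Euc d) u : EuclideanSpace ℝ (Fin d) → Euc d) a = w := by
  have : Fact (Module.finrank ℝ (Euc d) = d + 1) := ⟨finrank_euclideanSpace_fin⟩
  have h := range_mvfderiv_subtypeVal (n := d) u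
  have h2 : w ∈ (ℝ ∙ (u : Euc d))ᗮ := Submodule.mem_orthogonal_singleton_iff_inner_right.2 hw
  rw [← h] at h2
  exact h2
end SphereCalculus

/-! ### Gram determinants in a frame adapted to a hypersurface. -/

section Gram

variable {d : ℕ}

theorem det_of_first_column {M : Matrix (Fin (d + 1)) (Fin (d + 1)) ℝ}
    (h : ∀ i : Fin d, M i.succ 0 = 0) :
    M.det = M 0 0 * (M.submatrix Fin.succ Fin.succ).det := by
  rw [Matrix.det_succ_column_zero, Fin.sum_univ_succ]
  simp [h]

/-- The matrix of coordinates of a family of vectors. -/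
def coordMatrix (a : Fin (d + 1) → Euc d) : Matrix (Fin (d + 1)) (Fin (d + 1)) ℝ :=
  Matrix.of fun i k => a i k

theorem det_inner_eq (a c : Fin (d + 1) → Euc d) :
    (Matrix.of fun i j => ⟪a i, c j⟫).det = (coordMatrix a).det * (coordMatrix c).det := by
  rw [← Matrix.det_transpose (coordMatrix c), ← Matrix.det_mul]
  congr 1
  ext i j
  simp [coordMatrix, Matrix.mul_apply, PiLp.inner_apply, mul_comm]

theorem det_coordMatrix_comp (W : Euc d →L[ℝ] Euc d) (a : Fin (d + 1) → Euc d) :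
    (coordMatrix fun i => W (a i)).det = W.det * (coordMatrix a).det := by
  set b := (EuclideanSpace.basisFun (Fin (d + 1)) ℝ).toBasis
  rw [ContinuousLinearMap.det, ← LinearMap.det_toMatrix b, ← Matrix.det_transpose
    (LinearMap.toMatrix b b _), mul_comm, ← Matrix.det_mul]
  congr 1
  ext i k
  have h := congrFun (LinearMap.toMatrix_mulVec_repr b b (W : Euc d →ₗ[ℝ] Euc d) (a i)) k
  simp only [Matrix.mulVec, dotProduct] at h
  simp only [coordMatrix, Matrix.mul_apply, Matrix.of_apply, Matrix.transpose_apply]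
  have hb : ∀ (x : Euc d) l, b.repr x l = x l := fun x l => by simp [b]
  simp only [hb] at h
  rw [show W (a i) k = _ from h.symm]
  exact Finset.sum_congr rfl fun l _ => mul_comm _ _

/-- Complete the tangent frame `e` by `z` and by `ν`. Since `W z` is orthogonal to the tangent space
and `⟪W z, z⟫ = 1`, each enlarged Gram matrix is block triangular, and the two completions differ in
determinant by the factor `⟪z, ν⟫`. -/
theorem det_hessian_frame {W : Euc d →L[ℝ] Euc d} (hW : ∀ v w, ⟪W v, w⟫ = ⟪v, W w⟫)
    {z ν : Euc d} {e : Fin d → Euc d} (hν : ‖ν‖ = 1) (he : ∀ i, ⟪e i, ν⟫ = 0)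
    (hz : ⟪W z, z⟫ = 1) (hze : ∀ i, ⟪W z, e i⟫ = 0)
    (hI : (Matrix.of fun i j => ⟪e i, e j⟫).det ≠ 0) :
    (Matrix.of fun i j => ⟪W (e i), e j⟫).det =
      W.det * ⟪z, ν⟫ ^ 2 * (Matrix.of fun i j => ⟪e i, e j⟫).det := by
  set a : Fin (d + 1) → Euc d := Fin.cons z e
  set c : Fin (d + 1) → Euc d := Fin.cons ν e
  have h1 : (Matrix.of fun i j => ⟪W (e i), e j⟫).det =
      W.det * (coordMatrix a).det * (coordMatrix a).det := by
    rw [← det_coordMatrix_comp, ← det_inner_eq, det_of_first_column]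
    · simp only [Matrix.of_apply, a, Fin.cons_zero, hz, one_mul]
      rfl
    · intro i
      simp only [Matrix.of_apply, a, Fin.cons_zero, Fin.cons_succ]
      rw [real_inner_comm, ← hW, hze]
  have h2 : (Matrix.of fun i j => ⟪e i, e j⟫).det =
      (coordMatrix c).det * (coordMatrix c).det := by
    rw [← det_inner_eq, det_of_first_column]
    · simp only [Matrix.of_apply, c, Fin.cons_zero, real_inner_self_eq_norm_sq, hν, one_pow,
        one_mul]
      rfl
    · intro i
      simp [c, he]
  have h3 : ⟪z, ν⟫ * (Matrix.of fun i j => ⟪e i, e j⟫).det =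
      (coordMatrix a).det * (coordMatrix c).det := by
    rw [← det_inner_eq, det_of_first_column]
    · simp only [Matrix.of_apply, a, c, Fin.cons_zero]
      rfl
    · intro i
      simp [a, c, he]
  set D := (Matrix.of fun i j => ⟪e i, e j⟫).det
  set A := (coordMatrix a).det
  set C := (coordMatrix c).det
  have hC : C ≠ 0 := by
    rintro h
    exact hI (by rw [h2, h, zero_mul])
  have h4 : A = ⟪z, ν⟫ * C := by
    apply mul_right_cancel₀ hC
    rw [← h3, h2]; ring
  rw [h1, h2, h4]
  ring

end Gram

/-! ### Normal, Gauss curvature and Jacobian of a parametrised convex hypersurface. -/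

section Hypersurface

variable {d : ℕ} {K : Set (Euc d)} {X : Sph d → Euc d} {ν : Sph d → Sph d}

theorem gauge_eq_one_of_range (hc : Convex ℝ K) (h0 : (0 : Euc d) ∈ interior K)
    (hfr : frontier K = range X) (p : Sph d) : gauge K (X p) = 1 := by
  rw [gauge_eq_one_iff_mem_frontier hc (mem_interior_iff_mem_nhds.1 h0), hfr]
  exact mem_range_self p

theorem ne_zero_of_range (hc : Convex ℝ K) (h0 : (0 : Euc d) ∈ interior K)
    (hfr : frontier K = range X) (p : Sph d) : X p ≠ 0 := by
  intro h
  have := gauge_eq_one_of_range hc h0 hfr p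
  rw [h, gauge_zero] at this
  exact zero_ne_one this

theorem exists_gauge_smul_eq (hK : IsCompact K) (hc : Convex ℝ K) (h0 : (0 : Euc d) ∈ interior K)
    (hfr : frontier K = range X) {z : Euc d} (hz : z ≠ 0) : ∃ p, z = gauge K z • X p := by
  have hg := gauge_pos_of_ne hK h0 hz
  have : (gauge K z)⁻¹ • z ∈ frontier K := by
    rw [← gauge_eq_one_iff_mem_frontier hc (mem_interior_iff_mem_nhds.1 h0),
      gauge_pos_smul K (by positivity), inv_mul_cancel₀ hg.ne']
  rw [hfr] at this
  obtain ⟨p, hp⟩ := this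
  exact ⟨p, by rw [hp, smul_inv_smul₀ hg.ne']⟩

theorem direction_surjective (hK : IsCompact K) (hc : Convex ℝ K) (h0 : (0 : Euc d) ∈ interior K)
    (hfr : frontier K = range X) (u : Sph d) : ∃ p, direction (X p) = u := by
  obtain ⟨p, hp⟩ := exists_gauge_smul_eq hK hc h0 hfr (sphere_ne_zero u)
  refine ⟨p, ?_⟩
  rw [← direction_coe u, hp, direction_smul (gauge_pos_of_ne hK h0 (sphere_ne_zero u))
    (ne_zero_of_range hc h0 hfr p)]

theorem inner_normal_le (hK : IsCompact K) (hc : Convex ℝ K) (h0 : (0 : Euc d) ∈ interior K)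
    (hfr : frontier K = range X) (hν : IsOuterNormal X ν) (p : Sph d) (y : Euc d) :
    ⟪y, (ν p : Euc d)⟫ ≤ ⟪X p, (ν p : Euc d)⟫ * gauge K y := by
  by_cases hy : y = 0
  · simp [hy, gauge_zero]
  obtain ⟨q, hq⟩ := exists_gauge_smul_eq hK hc h0 hfr hy
  have h := hν p q
  rw [inner_sub_left] at h
  conv_lhs => rw [hq]
  rw [inner_smul_left, mul_comm]
  exact mul_le_mul_of_nonneg_right (by linarith) (gauge_nonneg _)

theorem inner_normal_pos (hK : IsCompact K) (hc : Convex ℝ K) (h0 : (0 : Euc d) ∈ interior K)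
    (hfr : frontier K = range X) (hν : IsOuterNormal X ν) (p : Sph d) :
    0 < ⟪X p, (ν p : Euc d)⟫ := by
  have h := inner_normal_le hK hc h0 hfr hν p (ν p)
  rw [real_inner_self_eq_norm_sq, norm_sphere] at h
  have := gauge_pos_of_ne hK h0 (sphere_ne_zero (ν p))
  by_contra hneg
  nlinarith

theorem smul_energyGrad_eq_normal (hK : IsSmoothBody K) (hfr : frontier K = range X)
    (hν : IsOuterNormal X ν) (p : Sph d) :
    ⟪X p, (ν p : Euc d)⟫ • energyGrad K (X p) = (ν p : Euc d) :=
  hK.smul_energyGrad_of_support (ne_zero_of_range hK.strictConvex.convex hK.zero_mem hfr p)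
    (gauge_eq_one_of_range hK.strictConvex.convex hK.zero_mem hfr p) rfl
    (inner_normal_le hK.compact hK.strictConvex.convex hK.zero_mem hfr hν p)

theorem norm_energyGrad_eq (hK : IsSmoothBody K) (hfr : frontier K = range X)
    (hν : IsOuterNormal X ν) (p : Sph d) :
    ‖energyGrad K (X p)‖ = ⟪X p, (ν p : Euc d)⟫⁻¹ := by
  have hpos := inner_normal_pos hK.compact hK.strictConvex.convex hK.zero_mem hfr hν p
  have h := congrArg norm (smul_energyGrad_eq_normal hK hfr hν p)
  rw [norm_smul, norm_sphere, Real.norm_of_nonneg hpos.le] at h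
  exact eq_inv_of_mul_eq_one_right h

/-- The normal is the normalised gradient of the energy, so up to a multiple of the normal its
derivative is the Hessian times the support value `h`. Its determinant on the tangent space
contributes `h ^ d`, and the change of frame contributes `h ^ 2`. -/
theorem gaussCurvature_eq (hK : IsSmoothBody K) (hX : IsSmoothEmbeddedSphere X)
    (hfr : frontier K = range X) (hν : IsOuterNormal X ν) (p : Sph d) :
    gaussCurvature X ν p = ⟪X p, (ν p : Euc d)⟫ ^ (d + 2) * (energyHess K (X p)).det := by
  have hz := ne_zero_of_range hK.strictConvex.convex hK.zero_mem hfr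
  have hg1 := gauge_eq_one_of_range hK.strictConvex.convex hK.zero_mem hfr
  have hpos := inner_normal_pos hK.compact hK.strictConvex.convex hK.zero_mem hfr hν
  have hXd : MDifferentiableAt (𝓡 d) 𝓘(ℝ, Euc d) X p := (hX.smooth p).mdifferentiableAt (by simp)
  have hV0 := hK.energyGrad_ne_zero (hz p)
  set V := energyGrad K (X p) with hV
  set h := ⟪X p, (ν p : Euc d)⟫ with hh
  set e : Fin d → Euc d := fun i => partialAt X p i with he
  have hνV : (ν p : Euc d) = h • V := (smul_energyGrad_eq_normal hK hfr hν p).symm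
  -- The energy is constantly `1 / 2` along the hypersurface, so its gradient is orthogonal to every
  -- tangent vector.
  have hVe : ∀ i, ⟪V, e i⟫ = 0 := by
    intro i
    have hE : DifferentiableAt ℝ (energy K) (X p) :=
      (hK.contDiffAt_energy (hz p)).differentiableAt (by simp)
    have h1 := mfderiv_comp_apply hXd hE (EuclideanSpace.single i (1 : ℝ))
    have h2 : (fun q => energy K (X q)) = fun _ => (1 / 2 : ℝ) := by
      funext q; simp [energy, hg1 q]
    rw [h2, mfderiv_const] at h1
    rw [hV, energyGrad, inner_gradient_left]
    exact h1.symm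
  have heν : ∀ i, ⟪e i, (ν p : Euc d)⟫ = 0 := by
    intro i
    rw [hνV, inner_smul_right, real_inner_comm, hVe, mul_zero]
  set N : Euc d → Euc d := fun y => ‖energyGrad K y‖⁻¹ • energyGrad K y with hN
  have hNX : (fun q => (ν q : Euc d)) = fun q => N (X q) := by
    funext q
    simp only [hN]
    rw [norm_energyGrad_eq hK hfr hν q, inv_inv, smul_energyGrad_eq_normal hK hfr hν q]
  have hVd := hK.hasFDerivAt_energyGrad (hz p)
  have hnd : DifferentiableAt ℝ (fun y => ‖energyGrad K y‖⁻¹) (X p) :=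
    (hVd.differentiableAt.norm ℝ hV0).inv (norm_ne_zero_iff.2 hV0)
  have hNd : HasFDerivAt N (‖V‖⁻¹ • energyHess K (X p) +
      (fderiv ℝ (fun y => ‖energyGrad K y‖⁻¹) (X p)).smulRight V) (X p) :=
    hnd.hasFDerivAt.smul hVd
  have hsec : ∀ i j, secondForm X ν p i j = h * ⟪energyHess K (X p) (e i), e j⟫ := by
    intro i j
    have h1 : partialAt (fun q => (ν q : Euc d)) p i =
        fderiv ℝ N (X p) (e i) := by
      rw [hNX]
      exact mfderiv_comp_apply hXd hNd.differentiableAt _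
    simp only [secondForm, Matrix.of_apply]
    rw [h1, hNd.fderiv]
    simp only [add_apply, smul_apply, ContinuousLinearMap.smulRight_apply, inner_add_left,
      inner_smul_left]
    have hVj : ⟪V, partialAt X p j⟫ = 0 := hVe j
    rw [hVj, norm_energyGrad_eq hK hfr hν p]
    simp [he, hh]
  have hI : (Matrix.of fun i j => ⟪e i, e j⟫).det ≠ 0 := by
    have : LinearIndependent ℝ e := by
      have hb := (EuclideanSpace.basisFun (Fin d) ℝ).toBasis.linearIndependent
      let L : EuclideanSpace ℝ (Fin d) →ₗ[ℝ] Euc d :=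
        (mfderiv (𝓡 d) 𝓘(ℝ, Euc d) X p).toLinearMap
      have hL : LinearMap.ker L = ⊥ := LinearMap.ker_eq_bot.2 (hX.immersion p)
      have := hb.map' L hL
      convert! this using 1
      ext i
      simp [he, partialAt, L]
      rfl
    exact Matrix.det_gram_ne_zero_iff_linearIndependent.2 this
  have hW := hK.energyHess_self (hz p)
  have hmain := det_hessian_frame (hK.energyHess_symm (hz p)) (norm_sphere (ν p)) heν
    (by rw [hW, hK.inner_energyGrad_self (hz p), hg1, one_pow])
    (fun i => by rw [hW]; exact hVe i) hI
  have hsecm : secondForm X ν p = h • Matrix.of fun i j => ⟪energyHess K (X p) (e i), e j⟫ := by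
    ext i j
    rw [hsec]; rfl
  have hfirst : firstForm X p = Matrix.of fun i j => ⟪e i, e j⟫ := rfl
  rw [gaussCurvature, hsecm, hfirst, Matrix.det_smul, hmain, Fintype.card_fin, ← hh]
  field_simp
  ring

theorem normalMap_direction (hK : IsSmoothBody K) (hfr : frontier K = range X)
    (hν : IsOuterNormal X ν) (p : Sph d) : normalMap K (direction (X p)) = ν p := by
  have hz := ne_zero_of_range hK.strictConvex.convex hK.zero_mem hfr p
  have hpos := inner_normal_pos hK.compact hK.strictConvex.convex hK.zero_mem hfr hν p
  have hn := norm_pos_iff.2 hz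
  rw [normalMap, coe_direction hz, hK.energyGrad_smul (by positivity) hz,
    direction_smul (by positivity) (hK.energyGrad_ne_zero hz),
    ← direction_smul hpos (hK.energyGrad_ne_zero hz), smul_energyGrad_eq_normal hK hfr hν p,
    direction_coe]

/-- This turns the speed of the flow into a Jacobian: up to `f / g`, the normal speed divided by the
support value is exactly the right-hand side. -/
theorem normalJacobian_direction (hK : IsSmoothBody K) (hX : IsSmoothEmbeddedSphere X)
    (hfr : frontier K = range X) (hν : IsOuterNormal X ν) (p : Sph d) :
    normalJacobian K (direction (X p)) =
      ‖X p‖ ^ (d + 1) * gaussCurvature X ν p / ⟪X p, (ν p : Euc d)⟫ := by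
  have hz := ne_zero_of_range hK.strictConvex.convex hK.zero_mem hfr p
  have hpos := inner_normal_pos hK.compact hK.strictConvex.convex hK.zero_mem hfr hν p
  have hn := norm_pos_iff.2 hz
  rw [gaussCurvature_eq hK hX hfr hν, normalJacobian, coe_direction hz,
    hK.energyGrad_smul (by positivity) hz, hK.energyHess_smul (by positivity) hz, norm_smul,
    norm_energyGrad_eq hK hfr hν p, norm_inv, norm_norm, ← mul_inv, inv_pow, div_inv_eq_mul]
  field_simp
  ring

end Hypersurface

/-! ### Regularity of the moving gauge and its scalar evolution equation. -/

section GaugeFlow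

variable {d : ℕ}

/-- A family of strictly convex bodies whose gauges solve the scalar evolution equation
which is equivalent to the flow. -/
structure IsGaugeFlow (f g : Sph d → ℝ) (T : EReal) (K : ℝ → Set (Euc d)) : Prop where
  compact : ∀ t ∈ timeInterval T, IsCompact (K t)
  strictConvex : ∀ t ∈ timeInterval T, StrictConvex ℝ (K t)
  zero_mem : ∀ t ∈ timeInterval T, (0 : Euc d) ∈ interior (K t)
  continuousOn : ∀ t ∈ timeInterval T,
    ContinuousOn (fun q : Sph d × ℝ => gauge (K q.2) q.1) (univ ×ˢ Icc 0 t)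
  smooth : ∀ t ∈ timeInterval T, 0 < t → ∀ z : Euc d, z ≠ 0 →
    ContDiffAt ℝ 2 (fun q : Euc d × ℝ => gauge (K q.2) q.1) (z, t)
  evolution : ∀ t ∈ timeInterval T, 0 < t → ∀ u : Sph d,
    HasDerivAt (fun s => gauge (K s) u)
      (gauge (K t) u * (f (normalMap (K t) u) / g u * normalJacobian (K t) u - 1)) t

theorem timeInterval_mem_nhds {T : EReal} {t : ℝ} (ht : t ∈ timeInterval T) (h0 : 0 < t) :
    timeInterval T ∈ 𝓝 t := by
  have h1 : ∀ᶠ s : ℝ in 𝓝 t, (s : EReal) < T :=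
    continuous_coe_real_ereal.continuousAt.eventually_lt continuousAt_const ht.2
  filter_upwards [lt_mem_nhds h0, h1] with s hs1 hs2 using ⟨hs1.le, hs2⟩

theorem Icc_subset_timeInterval {T : EReal} {t : ℝ} (ht : t ∈ timeInterval T) :
    Icc 0 t ⊆ timeInterval T := fun _ hs =>
  ⟨hs.1, lt_of_le_of_lt (EReal.coe_le_coe_iff.2 hs.2) ht.2⟩

theorem IsGaugeFlow.isSmoothBody {f g : Sph d → ℝ} {T : EReal} {K : ℝ → Set (Euc d)}
    (hK : IsGaugeFlow f g T K) {t : ℝ} (ht : t ∈ timeInterval T) (h0 : 0 < t) :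
    IsSmoothBody (K t) where
  compact := hK.compact t ht
  strictConvex := hK.strictConvex t ht
  zero_mem := hK.zero_mem t ht
  smooth z hz := by
    have := (hK.smooth t ht h0 z hz).comp z (f := fun y : Euc d => (y, t))
      (contDiffAt_id.prodMk contDiffAt_const)
    exact this.contDiffWithinAt

/-- The one-homogeneous extension in space of a moving hypersurface. -/
def coneMap (X : ℝ → Sph d → Euc d) (q : Euc d × ℝ) : Euc d := ‖q.1‖ • X q.2 (direction q.1)

theorem coneMap_coe (X : ℝ → Sph d → Euc d) (u : Sph d) (t : ℝ) :
    coneMap X ((u : Euc d), t) = X t u := by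
  simp [coneMap, direction_coe]

theorem contDiffAt_coneMap {T : EReal} {X : ℝ → Sph d → Euc d}
    (hX : ContMDiffOn ((𝓡 d).prod 𝓘(ℝ, ℝ)) 𝓘(ℝ, Euc d) ∞
      (fun p : Sph d × ℝ => X p.2 p.1) (univ ×ˢ timeInterval T))
    {y : Euc d} (hy : y ≠ 0) {t : ℝ} (ht : timeInterval T ∈ 𝓝 t) :
    ContDiffAt ℝ ∞ (coneMap X) (y, t) := by
  have h1 : ContMDiffAt 𝓘(ℝ, Euc d × ℝ) (𝓡 d) ∞ (fun q : Euc d × ℝ => direction q.1) (y, t) :=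
    (contMDiffAt_direction hy).comp (f := fun q : Euc d × ℝ => q.1) (y, t)
      contDiffAt_fst.contMDiffAt
  have h2 : ContMDiffAt 𝓘(ℝ, Euc d × ℝ) 𝓘(ℝ, ℝ) ∞ (fun q : Euc d × ℝ => q.2) (y, t) :=
    contDiffAt_snd.contMDiffAt
  have h3 : ContMDiffAt ((𝓡 d).prod 𝓘(ℝ, ℝ)) 𝓘(ℝ, Euc d) ∞
      (fun p : Sph d × ℝ => X p.2 p.1) (direction y, t) :=
    hX.contMDiffAt (prod_mem_nhds Filter.univ_mem ht)
  have h4 : ContMDiffAt 𝓘(ℝ, Euc d × ℝ) 𝓘(ℝ, Euc d) ∞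
      (fun q : Euc d × ℝ => X q.2 (direction q.1)) (y, t) :=
    ContMDiffAt.comp (f := fun q : Euc d × ℝ => (direction q.1, q.2)) (y, t) h3 (h1.prodMk h2)
  exact ((contDiffAt_norm ℝ hy).comp (f := fun q : Euc d × ℝ => q.1) (y, t) contDiffAt_fst).smul
    h4.contDiffAt

/-- By homogeneity the supporting hyperplane at `X t u` bounds the whole cone map, with equality at
`u`; the first-order condition at this minimum is the formula. -/
theorem inner_fderiv_coneMap {X : ℝ → Sph d → Euc d} {ν : Sph d → Sph d} {u : Sph d} {t : ℝ}
    (hd : DifferentiableAt ℝ (coneMap X) ((u : Euc d), t)) (hν : IsOuterNormal (X t) ν)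
    (v : Euc d) :
    ⟪fderiv ℝ (coneMap X) ((u : Euc d), t) (v, 0), (ν u : Euc d)⟫ =
      ⟪X t u, (ν u : Euc d)⟫ * ⟪(u : Euc d), v⟫ := by
  set h := ⟪X t u, (ν u : Euc d)⟫ with hh
  have h1 : HasFDerivAt (fun y : Euc d => coneMap X (y, t))
      ((fderiv ℝ (coneMap X) ((u : Euc d), t)).comp (ContinuousLinearMap.inl ℝ (Euc d) ℝ)) u :=
    HasFDerivAt.comp (f := fun y : Euc d => (y, t)) (u : Euc d) hd.hasFDerivAt
      (hasFDerivAt_prodMk_left _ _)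
  have h2 := h1.inner ℝ (hasFDerivAt_const ((ν u : Euc d)) (u : Euc d))
  have h3 : DifferentiableAt ℝ (fun y : Euc d => ‖y‖) (u : Euc d) :=
    differentiableAt_id.norm ℝ (sphere_ne_zero u)
  have h3' : fderiv ℝ (fun y : Euc d => ‖y‖) (u : Euc d) v = ⟪(u : Euc d), v⟫ := by
    have := ((hasStrictFDerivAt_norm_sq (u : Euc d)).hasFDerivAt).unique (h3.hasFDerivAt.pow 2)
    have := congrArg (fun L : Euc d →L[ℝ] ℝ => L v) this
    simp at this
    linarith
  have hmin : IsLocalMin (fun y : Euc d => h * ‖y‖ - ⟪coneMap X (y, t), (ν u : Euc d)⟫) u := by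
    refine Filter.Eventually.of_forall fun y => ?_
    have := hν u (direction y)
    rw [inner_sub_left] at this
    simp only [coneMap, inner_smul_left, norm_sphere, direction_coe, conj_trivial]
    nlinarith [norm_nonneg y]
  have h4 := hmin.hasFDerivAt_eq_zero ((h3.hasFDerivAt.const_mul h).sub h2)
  have h5 := congrArg (fun L : Euc d →L[ℝ] ℝ => L v) h4
  simp [h3'] at h5
  linarith

/-- A kernel vector is tangent to the sphere by the normal component of the derivative, and then
vanishes because `X t` is an immersion. -/
theorem fderiv_coneMap_injective {X : ℝ → Sph d → Euc d} {ν : Sph d → Sph d} {u : Sph d} {t : ℝ}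
    (hd : DifferentiableAt ℝ (coneMap X) ((u : Euc d), t)) (hν : IsOuterNormal (X t) ν)
    (hpos : 0 < ⟪X t u, (ν u : Euc d)⟫)
    (himm : Function.Injective (mfderiv (𝓡 d) 𝓘(ℝ, Euc d) (X t) u)) {v : Euc d}
    (hv : fderiv ℝ (coneMap X) ((u : Euc d), t) (v, 0) = 0) : v = 0 := by
  have h0 := inner_fderiv_coneMap hd hν v
  rw [hv, inner_zero_left, eq_comm, mul_eq_zero] at h0
  obtain ⟨a, rfl⟩ := exists_mfderiv_coe_eq u (h0.resolve_left hpos.ne')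
  have h1 : HasFDerivAt (fun y : Euc d => coneMap X (y, t))
      ((fderiv ℝ (coneMap X) ((u : Euc d), t)).comp (ContinuousLinearMap.inl ℝ (Euc d) ℝ)) u :=
    HasFDerivAt.comp (f := fun y : Euc d => (y, t)) (u : Euc d) hd.hasFDerivAt
      (hasFDerivAt_prodMk_left _ _)
  have h2 := mfderiv_comp_apply (mdifferentiableAt_coe u) h1.differentiableAt a
  have h3 : (fun q : Sph d => coneMap X ((q : Euc d), t)) = X t := by
    funext q; exact coneMap_coe X q t
  rw [h3, h1.fderiv] at h2
  have h4 : (mfderiv (𝓡 d) 𝓘(ℝ, Euc d) (X t) u : EuclideanSpace ℝ (Fin d) → Euc d) a = 0 :=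
    h2.trans hv
  have h5 : a = 0 := himm (Eq.trans h4 (map_zero _).symm)
  rw [h5]
  exact map_zero _

variable {f g : Sph d → ℝ} {T : EReal} {X : ℝ → Sph d → Euc d} {ν : ℝ → Sph d → Sph d}
  {K : ℝ → Set (Euc d)}

/-- The inverse function theorem applies to `(y, t) ↦ (coneMap X (y, t), t)`. Since the hypersurface
has gauge one, the gauge of an image point is the norm of its preimage, hence smooth jointly in
space and time. -/
theorem contDiffAt_gauge_at_surface (hX : IsStrictlyConvexSolution f g T X ν)
    (hc : ∀ t ∈ timeInterval T, IsCompact (K t))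
    (hs : ∀ t ∈ timeInterval T, StrictConvex ℝ (K t))
    (h0 : ∀ t ∈ timeInterval T, (0 : Euc d) ∈ interior (K t))
    (hfr : ∀ t ∈ timeInterval T, frontier (K t) = range (X t))
    {t : ℝ} (ht : t ∈ timeInterval T) (htpos : 0 < t) (u : Sph d) :
    ContDiffAt ℝ ∞ (fun q : Euc d × ℝ => gauge (K q.2) q.1) (X t u, t) := by
  have hI := timeInterval_mem_nhds ht htpos
  have hcone := contDiffAt_coneMap hX.smooth (sphere_ne_zero u) hI
  have hdiff : DifferentiableAt ℝ (coneMap X) ((u : Euc d), t) := hcone.differentiableAt (by simp)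
  set Φ : Euc d × ℝ → Euc d × ℝ := fun q => (coneMap X q, q.2) with hΦ
  have hΦs : ContDiffAt ℝ ∞ Φ ((u : Euc d), t) := hcone.prodMk contDiffAt_snd
  set L : (Euc d × ℝ) →L[ℝ] (Euc d × ℝ) :=
    (fderiv ℝ (coneMap X) ((u : Euc d), t)).prod (ContinuousLinearMap.snd ℝ (Euc d) ℝ) with hL
  have hΦd : HasFDerivAt Φ L ((u : Euc d), t) := hdiff.hasFDerivAt.prodMk hasFDerivAt_snd
  have hinj : Function.Injective (L : (Euc d × ℝ) →ₗ[ℝ] (Euc d × ℝ)) := by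
    rw [← LinearMap.ker_eq_bot, LinearMap.ker_eq_bot']
    rintro ⟨v, s⟩ hvs
    have h1 := congrArg Prod.fst hvs
    have h2 := congrArg Prod.snd hvs
    simp [hL] at h1 h2
    subst h2
    have := fderiv_coneMap_injective hdiff (hX.normal t ht)
      (inner_normal_pos (hc t ht) (hs t ht).convex (h0 t ht) (hfr t ht) (hX.normal t ht) u)
      ((hX.embedded t ht).immersion u) h1
    simp [this]
  set Le : (Euc d × ℝ) ≃L[ℝ] (Euc d × ℝ) :=
    (LinearEquiv.ofInjectiveEndo (L : (Euc d × ℝ) →ₗ[ℝ] (Euc d × ℝ)) hinj).toContinuousLinearEquiv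
  have hLe : (Le : (Euc d × ℝ) →L[ℝ] (Euc d × ℝ)) = L := by
    ext v <;> rfl
  rw [← hLe] at hΦd
  have hn : (∞ : ℕ∞ω) ≠ 0 := by simp
  set Ψ := hΦs.localInverse hΦd hn with hΨ
  have hval : Φ ((u : Euc d), t) = (X t u, t) := by simp only [hΦ, coneMap_coe]
  have hΨs : ContDiffAt ℝ ∞ Ψ (X t u, t) := hval ▸ hΦs.to_localInverse hΦd hn
  have hΨ0 : Ψ (X t u, t) = ((u : Euc d), t) := by
    rw [← hval]; exact hΦs.localInverse_apply_image hΦd hn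
  have hright : ∀ᶠ q in 𝓝 (X t u, t), Φ (Ψ q) = q := by
    rw [← hval]
    exact (hΦs.hasStrictFDerivAt' hΦd hn).eventually_right_inverse
  have hfst : ContDiffAt ℝ ∞ (fun q => (Ψ q).1) (X t u, t) := contDiffAt_fst.comp _ hΨs
  have hne : (Ψ (X t u, t)).1 ≠ 0 := by rw [hΨ0]; exact sphere_ne_zero u
  have hnorm : ContDiffAt ℝ ∞ (fun q => ‖(Ψ q).1‖) (X t u, t) := hfst.norm ℝ hne
  refine hnorm.congr_of_eventuallyEq ?_
  have hev1 : ∀ᶠ q : Euc d × ℝ in 𝓝 (X t u, t), q.2 ∈ timeInterval T :=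
    continuousAt_snd.eventually hI
  filter_upwards [hright, hev1] with q hq hqt
  have h2 : (Ψ q).2 = q.2 := (Prod.ext_iff.1 hq).2
  have h3 : coneMap X (Ψ q) = q.1 := (Prod.ext_iff.1 hq).1
  rw [← h3, coneMap, gauge_pos_smul _ (norm_nonneg _), h2,
    gauge_eq_one_of_range (hs _ hqt).convex (h0 _ hqt) (hfr _ hqt), mul_one]

theorem contDiffAt_gauge_of_solution (hX : IsStrictlyConvexSolution f g T X ν)
    (hc : ∀ t ∈ timeInterval T, IsCompact (K t))
    (hs : ∀ t ∈ timeInterval T, StrictConvex ℝ (K t))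
    (h0 : ∀ t ∈ timeInterval T, (0 : Euc d) ∈ interior (K t))
    (hfr : ∀ t ∈ timeInterval T, frontier (K t) = range (X t))
    {t : ℝ} (ht : t ∈ timeInterval T) (htpos : 0 < t) {z : Euc d} (hz : z ≠ 0) :
    ContDiffAt ℝ ∞ (fun q : Euc d × ℝ => gauge (K q.2) q.1) (z, t) := by
  obtain ⟨p, hp⟩ := exists_gauge_smul_eq (hc t ht) (hs t ht).convex (h0 t ht) (hfr t ht) hz
  have hcpos := gauge_pos_of_ne (hc t ht) (h0 t ht) hz
  set c := gauge (K t) z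
  have hsurf := contDiffAt_gauge_at_surface hX hc hs h0 hfr ht htpos p
  have hXp : X t p = c⁻¹ • z := by rw [hp, inv_smul_smul₀ hcpos.ne']
  rw [hXp] at hsurf
  have h1 : ContDiffAt ℝ ∞ (fun q : Euc d × ℝ => (c⁻¹ • q.1, q.2)) (z, t) :=
    (contDiffAt_fst.const_smul _).prodMk contDiffAt_snd
  have h2 := (ContDiffAt.comp (f := fun q : Euc d × ℝ => (c⁻¹ • q.1, q.2)) (z, t) hsurf h1).const_smul c
  refine h2.congr_of_eventuallyEq (Filter.Eventually.of_forall fun q => ?_)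
  simp only [Function.comp_apply, smul_eq_mul]
  rw [gauge_pos_smul _ (by positivity), mul_inv_cancel_left₀ hcpos.ne']

/-- The inverse function argument needs a neighbourhood in time, so the initial time is reached only
by continuity, obtained from compactness. -/
theorem continuousOn_gauge_of_solution (hX : IsStrictlyConvexSolution f g T X ν)
    (hc : ∀ t ∈ timeInterval T, IsCompact (K t))
    (hs : ∀ t ∈ timeInterval T, StrictConvex ℝ (K t))
    (h0 : ∀ t ∈ timeInterval T, (0 : Euc d) ∈ interior (K t))
    (hfr : ∀ t ∈ timeInterval T, frontier (K t) = range (X t))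
    {t : ℝ} (ht : t ∈ timeInterval T) :
    ContinuousOn (fun q : Sph d × ℝ => gauge (K q.2) q.1) (univ ×ˢ Icc 0 t) := by
  have hsub := Icc_subset_timeInterval ht
  have hXc : Continuous fun q : Sph d × Icc 0 t => X q.2 q.1 :=
    hX.smooth.continuousOn.comp_continuous (f := fun q : Sph d × Icc 0 t => (q.1, (q.2 : ℝ)))
      (by fun_prop) fun q => ⟨mem_univ _, hsub q.2.2⟩
  have hne : ∀ q : Sph d × Icc 0 t, X q.2 q.1 ≠ 0 := fun q =>
    ne_zero_of_range (hs _ (hsub q.2.2)).convex (h0 _ (hsub q.2.2)) (hfr _ (hsub q.2.2)) q.1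
  set π : Sph d × Icc 0 t → Sph d × Icc 0 t := fun q => (direction (X q.2 q.1), q.2) with hπ
  have hπc : Continuous π :=
    (continuousOn_direction.comp_continuous hXc hne).prodMk continuous_snd
  have hπs : Function.Surjective π := by
    rintro ⟨u, s⟩
    obtain ⟨p, hp⟩ := direction_surjective (hc _ (hsub s.2)) (hs _ (hsub s.2)).convex
      (h0 _ (hsub s.2)) (hfr _ (hsub s.2)) u
    exact ⟨(p, s), by simp [hπ, hp]⟩
  -- A continuous surjection from a compact space to a Hausdorff one is a quotient map, so
  -- continuity may be tested on the parametrisation, where the gauge is `‖X‖⁻¹`.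
  have hquot : IsQuotientMap π := hπc.isClosedMap.isQuotientMap hπc hπs
  have hG : Continuous fun q : Sph d × Icc 0 t => gauge (K q.2) (q.1 : Euc d) := by
    rw [hquot.continuous_iff]
    have : (fun q : Sph d × Icc 0 t => gauge (K q.2) (q.1 : Euc d)) ∘ π =
        fun q => ‖X q.2 q.1‖⁻¹ := by
      funext q
      simp only [hπ, Function.comp_apply]
      rw [coe_direction (hne q), gauge_pos_smul _ (by positivity),
        gauge_eq_one_of_range (hs _ (hsub q.2.2)).convex (h0 _ (hsub q.2.2))
          (hfr _ (hsub q.2.2)), mul_one]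
    rw [this]
    exact hXc.norm.inv₀ fun q => norm_ne_zero_iff.2 (hne q)
  rintro ⟨u, s⟩ ⟨-, hst⟩
  have h1 := hG.continuousAt (x := (u, ⟨s, hst⟩))
  rw [ContinuousWithinAt, nhdsWithin_prod_eq, nhdsWithin_univ, nhdsWithin_eq_map_subtype_coe hst]
  rw [ContinuousAt, nhds_prod_eq] at h1
  rw [← Filter.map_id (f := 𝓝 u), Filter.prod_map_map_eq, Filter.tendsto_map'_iff]
  exact h1

theorem evolution_of_solution (hX : IsStrictlyConvexSolution f g T X ν)
    (hg : ∀ u, 0 < g u)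
    (hc : ∀ t ∈ timeInterval T, IsCompact (K t))
    (hs : ∀ t ∈ timeInterval T, StrictConvex ℝ (K t))
    (h0 : ∀ t ∈ timeInterval T, (0 : Euc d) ∈ interior (K t))
    (hfr : ∀ t ∈ timeInterval T, frontier (K t) = range (X t))
    {t : ℝ} (ht : t ∈ timeInterval T) (htpos : 0 < t) (hK : IsSmoothBody (K t)) (u : Sph d) :
    HasDerivAt (fun s => gauge (K s) u)
      (gauge (K t) u * (f (normalMap (K t) u) / g u * normalJacobian (K t) u - 1)) t := by
  have hI := timeInterval_mem_nhds ht htpos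
  obtain ⟨p, rfl⟩ := direction_surjective (hc t ht) (hs t ht).convex (h0 t ht) (hfr t ht) u
  have hz := ne_zero_of_range (hs t ht).convex (h0 t ht) (hfr t ht) p
  have hg1 := gauge_eq_one_of_range (hs t ht).convex (h0 t ht) (hfr t ht) p
  have hpos := inner_normal_pos (hc t ht) (hs t ht).convex (h0 t ht) (hfr t ht) (hX.normal t ht) p
  set J : Euc d × ℝ → ℝ := fun q => gauge (K q.2) q.1 with hJ
  have hJd : HasFDerivAt J (fderiv ℝ J (X t p, t)) (X t p, t) :=
    ((contDiffAt_gauge_of_solution hX hc hs h0 hfr ht htpos hz).differentiableAt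
      (by simp)).hasFDerivAt
  set D := fderiv ℝ J (X t p, t)
  set w := -((f (ν t p) / g (direction (X t p))) * ‖X t p‖ ^ (d + 1) *
          gaussCurvature (X t) (ν t) p) • (ν t p : Euc d) + X t p with hw
  have hflow : HasDerivAt (fun s => X s p) w t := (hX.flow t ht p).hasDerivAt hI
  have h1 : HasDerivAt (fun s => J (X s p, s)) (D (w, 1)) t :=
    HasFDerivAt.comp_hasDerivAt (f := fun s => (X s p, s)) t hJd (hflow.prodMk (hasDerivAt_id t))
  -- Differentiating the identity `gauge (K s) (X s p) = 1` along the flow expresses the time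
  -- derivative of the gauge by its space derivative in the direction of the velocity.
  have h2 : (fun s => J (X s p, s)) =ᶠ[𝓝 t] fun _ => 1 := by
    filter_upwards [hI] with s hst
    exact gauge_eq_one_of_range (hs s hst).convex (h0 s hst) (hfr s hst) p
  have h3 : D (w, 1) = 0 := h1.unique ((hasDerivAt_const t (1 : ℝ)).congr_of_eventuallyEq h2)
  have h4 : HasDerivAt (fun s => J (X t p, s)) (D (0, 1)) t :=
    HasFDerivAt.comp_hasDerivAt (f := fun s => (X t p, s)) t hJd
      ((hasDerivAt_const t _).prodMk (hasDerivAt_id t))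
  have h5 : HasFDerivAt (gauge (K t)) (D.comp (ContinuousLinearMap.inl ℝ (Euc d) ℝ)) (X t p) :=
    HasFDerivAt.comp (f := fun y : Euc d => (y, t)) (X t p) hJd (hasFDerivAt_prodMk_left _ _)
  have h6 : D (w, 0) = ⟪energyGrad (K t) (X t p), w⟫ := by
    rw [hK.inner_energyGrad hz, hg1, one_mul, h5.fderiv]
    rfl
  have h7 : D (0, 1) = -⟪energyGrad (K t) (X t p), w⟫ := by
    have : D (w, 1) = D (w, 0) + D (0, 1) := by rw [← map_add]; simp
    rw [← h6]; linarith
  have hV : energyGrad (K t) (X t p) = ⟪X t p, (ν t p : Euc d)⟫⁻¹ • (ν t p : Euc d) := by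
    rw [eq_inv_smul_iff₀ hpos.ne', smul_energyGrad_eq_normal hK (hfr t ht) (hX.normal t ht) p]
  have h8 : HasDerivAt (fun s => gauge (K s) (direction (X t p) : Euc d))
      (‖X t p‖⁻¹ * D (0, 1)) t := by
    refine (h4.const_mul ‖X t p‖⁻¹).congr_of_eventuallyEq
      (Filter.Eventually.of_forall fun s => ?_)
    simp only [hJ, coe_direction hz]
    rw [gauge_pos_smul _ (by positivity)]
  have hn := norm_pos_iff.2 hz
  have hgu := hg (direction (X t p))
  convert! h8 using 1
  rw [h7, hV, normalMap_direction hK (hfr t ht) (hX.normal t ht),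
    normalJacobian_direction hK (hX.embedded t ht) (hfr t ht) (hX.normal t ht), hw,
    coe_direction hz, gauge_pos_smul _ (by positivity), hg1, inner_smul_left, inner_add_right,
    inner_smul_right, real_inner_self_eq_norm_sq, norm_sphere,
    real_inner_comm (X t p) (ν t p : Euc d)]
  simp only [conj_trivial]
  field_simp
  ring

theorem isGaugeFlow_of_solution (hX : IsStrictlyConvexSolution f g T X ν)
    (hg : ∀ u, 0 < g u)
    (hc : ∀ t ∈ timeInterval T, IsCompact (K t))
    (hs : ∀ t ∈ timeInterval T, StrictConvex ℝ (K t))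
    (h0 : ∀ t ∈ timeInterval T, (0 : Euc d) ∈ interior (K t))
    (hfr : ∀ t ∈ timeInterval T, frontier (K t) = range (X t)) : IsGaugeFlow f g T K where
  compact := hc
  strictConvex := hs
  zero_mem := h0
  continuousOn _ ht := continuousOn_gauge_of_solution hX hc hs h0 hfr ht
  smooth _ ht htpos _ hz :=
    (contDiffAt_gauge_of_solution hX hc hs h0 hfr ht htpos hz).of_le (WithTop.coe_le_coe.2 le_top)
  evolution t ht htpos u := by
    refine evolution_of_solution hX hg hc hs h0 hfr ht htpos ?_ u
    refine ⟨hc t ht, hs t ht, h0 t ht, fun z hz => ?_⟩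
    have := ((contDiffAt_gauge_of_solution hX hc hs h0 hfr ht htpos hz).of_le
      (m := 2) (WithTop.coe_le_coe.2 le_top)).comp z (f := fun y : Euc d => (y, t))
      (contDiffAt_id.prodMk contDiffAt_const)
    exact this.contDiffWithinAt

end GaugeFlow

/-! ### Monotonicity from lower barriers, and parameter-dependent integrals and suprema. -/

section Barrier

/-- A function touching `M` from below on the left of `t` bounds the left difference quotients of
`M` from above. Reversing time turns them into right difference quotients, to which the standard
comparison criterion applies. `M` itself need not be differentiable, and nothing is asked at the
initial time. -/
theorem le_of_lower_barrier {M : ℝ → ℝ} {a b : ℝ} (hab : a ≤ b) (hM : ContinuousOn M (Icc a b))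
    (h : ∀ t ∈ Ioc a b, ∃ (φ : ℝ → ℝ) (c : ℝ), HasDerivAt φ c t ∧ c ≤ 0 ∧ φ t = M t ∧
      ∀ s ∈ Ioo a t, φ s ≤ M s) : M b ≤ M a := by
  set N : ℝ → ℝ := fun s => -M (a + b - s) with hN
  have hmaps : MapsTo (fun s => a + b - s) (Icc a b) (Icc a b) := fun s hs =>
    ⟨by linarith [hs.2], by linarith [hs.1]⟩
  have hNc : ContinuousOn N (Icc a b) := (hM.comp (by fun_prop) hmaps).neg
  have key := image_le_of_liminf_slope_right_le_deriv_boundary (f := N) (a := a) (b := b) hNc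
    (B := fun _ => N a) (B' := fun _ => 0) le_rfl continuousOn_const
    (fun x _ => (hasDerivWithinAt_const _ _ _)) ?_ (right_mem_Icc.2 hab)
  · simp only [hN] at key
    have h1 : a + b - b = a := by ring
    have h2 : a + b - a = b := by ring
    rw [h1, h2] at key
    linarith
  · intro x hx r hr
    have ht : a + b - x ∈ Ioc a b := ⟨by linarith [hx.2], by linarith [hx.1]⟩
    obtain ⟨φ, c, hφ, hc, heq, hle⟩ := h _ ht
    have hψ : HasDerivAt (fun s => -φ (a + b - s)) c x := by
      have h1 : HasDerivAt (fun s : ℝ => a + b - s) (-1) x := by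
        simpa using (hasDerivAt_id x).const_sub (a + b)
      have h2 := (HasDerivAt.comp (h := fun s : ℝ => a + b - s) x hφ h1).neg
      rw [mul_neg_one, neg_neg] at h2
      exact h2
    have hslope := (hasDerivWithinAt_iff_tendsto_slope' (s := Ioi x) (by simp)).1
      hψ.hasDerivWithinAt
    have hev : ∀ᶠ z in 𝓝[>] x, slope (fun s => -φ (a + b - s)) x z < r :=
      hslope.eventually (gt_mem_nhds (lt_of_le_of_lt hc hr))
    refine Filter.Eventually.frequently ?_
    filter_upwards [hev, Ioo_mem_nhdsGT hx.2] with z hz hzx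
    refine lt_of_le_of_lt ?_ hz
    rw [slope_def_field, slope_def_field]
    have h3 := hle (a + b - z) ⟨by linarith [hzx.2], by linarith [hzx.1]⟩
    refine div_le_div_of_nonneg_right ?_ (by linarith [hzx.1])
    simp only [hN]
    linarith

theorem hasDerivAt_integral_of_continuousOn {Y : Type*} [TopologicalSpace Y] [CompactSpace Y]
    [MeasurableSpace Y] [OpensMeasurableSpace Y] {μ : Measure Y} [IsFiniteMeasure μ]
    {F F' : Y → ℝ → ℝ} {t : ℝ} {S : Set ℝ} (hS : S ∈ 𝓝 t)
    (hF : ∀ s ∈ S, Continuous fun y => F y s)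
    (hF' : ContinuousOn (fun q : Y × ℝ => F' q.1 q.2) (univ ×ˢ S))
    (hd : ∀ y, ∀ s ∈ S, HasDerivAt (F y) (F' y s) s) :
    HasDerivAt (fun s => ∫ y, F y s ∂μ) (∫ y, F' y t ∂μ) t := by
  obtain ⟨ε, hε, hball⟩ := Metric.nhds_basis_closedBall.mem_iff.1 hS
  have hcomp : IsCompact ((univ : Set Y) ×ˢ closedBall t ε) :=
    isCompact_univ.prod (isCompact_closedBall t ε)
  obtain ⟨C, hC⟩ := hcomp.exists_bound_of_continuousOn
    (hF'.mono (prod_mono_right hball))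
  have hF's : Continuous fun y => F' y t :=
    hF'.comp_continuous (f := fun y => (y, t)) (by fun_prop)
      fun y => ⟨mem_univ _, mem_of_mem_nhds hS⟩
  refine (hasDerivAt_integral_of_dominated_loc_of_deriv_le (μ := μ) (F := fun s y => F y s)
    (F' := fun s y => F' y s) (bound := fun _ => C) (closedBall_mem_nhds t hε) ?_ ?_ ?_ ?_ ?_
    ?_).2
  · filter_upwards [hS] with s hs
    exact (hF s hs).measurable.aestronglyMeasurable
  · exact (hF t (mem_of_mem_nhds hS)).integrable_of_hasCompactSupport
      (HasCompactSupport.of_compactSpace _)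
  · exact hF's.measurable.aestronglyMeasurable
  · exact Filter.Eventually.of_forall fun y s hs => hC (y, s) ⟨mem_univ _, hs⟩
  · exact integrable_const _
  · exact Filter.Eventually.of_forall fun y s hs => hd y s (hball hs)

theorem continuousOn_integral_of_continuousOn {Y : Type*} [TopologicalSpace Y] [CompactSpace Y]
    [MeasurableSpace Y] [OpensMeasurableSpace Y] {μ : Measure Y} [IsFiniteMeasure μ]
    {F : Y → ℝ → ℝ} {S : Set ℝ} (hS : IsCompact S)
    (hF : ContinuousOn (fun q : Y × ℝ => F q.1 q.2) (univ ×ˢ S)) :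
    ContinuousOn (fun s => ∫ y, F y s ∂μ) S := by
  obtain ⟨C, hC⟩ := (isCompact_univ.prod hS).exists_bound_of_continuousOn hF
  refine continuousOn_of_dominated (bound := fun _ => C) ?_ ?_ (integrable_const _) ?_
  · intro s hs
    exact (hF.comp_continuous (f := fun y => (y, s)) (by fun_prop)
      fun y => ⟨mem_univ _, hs⟩).measurable.aestronglyMeasurable
  · exact fun s hs => Filter.Eventually.of_forall fun y => hC (y, s) ⟨mem_univ _, hs⟩
  · exact Filter.Eventually.of_forall fun y =>
      hF.comp (f := fun s => (y, s)) (by fun_prop) fun s hs => ⟨mem_univ _, hs⟩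

theorem continuousOn_sSup_of_continuousOn {Y Z : Type*} [TopologicalSpace Y] [CompactSpace Y]
    [TopologicalSpace Z] {F : Z → Y → ℝ} {S : Set Z}
    (hF : ContinuousOn (fun q : Y × Z => F q.2 q.1) (univ ×ˢ S)) :
    ContinuousOn (fun z => sSup (range (F z))) S := by
  rw [continuousOn_iff_continuous_domRestrict]
  have h : Continuous (fun q : S × Y => F q.1 q.2) :=
    hF.comp_continuous (f := fun q : S × Y => (q.2, (q.1 : Z))) (by fun_prop)
      fun q => ⟨mem_univ _, q.1.2⟩
  have := isCompact_univ.continuous_sSup (f := fun (z : S) (y : Y) => F z y) h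
  simp only [image_univ] at this
  exact this

end Barrier

/-! ### Comparison of a body with its reflection at a touching point. -/

section Comparison

variable {d : ℕ} {K : Set (Euc d)}

/-- The function `c ^ 2 * energy K y - energy K (-y)` is nonnegative and vanishes at `z`; these are
the first- and second-order conditions there. -/
theorem energyHess_antipodal_le (hK : IsSmoothBody K) {c : ℝ} {z : Euc d} (hz : z ≠ 0)
    (hle : ∀ y, gauge K (-y) ≤ c * gauge K y) (heq : gauge K (-z) = c * gauge K z) :
    energyGrad K (-z) = -(c ^ 2 • energyGrad K z) ∧
      ∀ v, ⟪energyHess K (-z) v, v⟫ ≤ ⟪(c ^ 2 • energyHess K z) v, v⟫ := by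
  set φ : Euc d → ℝ := fun y => c ^ 2 * energy K y - energy K (-y) with hφ
  have hnz : -z ≠ 0 := neg_ne_zero.2 hz
  have hφs : ContDiffAt ℝ 2 φ z :=
    (contDiffAt_const.mul (hK.contDiffAt_energy hz)).sub
      (ContDiffAt.comp (f := fun y : Euc d => -y) z (hK.contDiffAt_energy hnz) contDiffAt_id.neg)
  have hmin : IsLocalMin φ z := by
    refine Filter.Eventually.of_forall fun y => ?_
    have h1 : (gauge K (-y)) ^ 2 ≤ (c * gauge K y) ^ 2 :=
      pow_le_pow_left₀ (gauge_nonneg _) (hle y) 2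
    simp only [hφ, energy, heq]
    nlinarith
  have hgrad : ∀ y : Euc d, y ≠ 0 → HasGradientAt φ (c ^ 2 • energyGrad K y + energyGrad K (-y)) y := by
    intro y hy
    have h1 : HasFDerivAt (energy K) (InnerProductSpace.toDual ℝ _ (energyGrad K y)) y :=
      hasGradientAt_iff_hasFDerivAt.1
        ((hK.contDiffAt_energy hy).differentiableAt (by simp)).hasGradientAt
    have h2 : HasFDerivAt (energy K) (InnerProductSpace.toDual ℝ _ (energyGrad K (-y))) (-y) :=
      hasGradientAt_iff_hasFDerivAt.1
        ((hK.contDiffAt_energy (neg_ne_zero.2 hy)).differentiableAt (by simp)).hasGradientAt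
    have h3 := (h1.const_mul (c ^ 2)).sub
      (HasFDerivAt.comp (f := fun y : Euc d => -y) y h2 (hasFDerivAt_id y).neg)
    rw [hasGradientAt_iff_hasFDerivAt]
    refine h3.congr_fderiv ?_
    ext v
    simp
  have h0 : c ^ 2 • energyGrad K z + energyGrad K (-z) = 0 := by
    have := hmin.hasFDerivAt_eq_zero (hasGradientAt_iff_hasFDerivAt.1 (hgrad z hz))
    exact (InnerProductSpace.toDual ℝ (Euc d)).injective (this.trans (map_zero _).symm)
  refine ⟨eq_neg_of_add_eq_zero_right h0, fun v => ?_⟩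
  have h1 := hessian_nonneg_of_isLocalMin hφs hmin v
  have h2 : gradient φ =ᶠ[𝓝 z] fun y => c ^ 2 • energyGrad K y + energyGrad K (-y) := by
    filter_upwards [isOpen_compl_singleton.mem_nhds hz] with y hy using (hgrad y hy).gradient
  have h3 := ((hK.hasFDerivAt_energyGrad hz).const_smul (c ^ 2)).add
    (HasFDerivAt.comp (f := fun y : Euc d => -y) z (hK.hasFDerivAt_energyGrad hnz)
      (hasFDerivAt_id z).neg)
  rw [h2.fderiv_eq, show fderiv ℝ (fun y => c ^ 2 • energyGrad K y + energyGrad K (-y)) z = _ from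
    h3.fderiv] at h1
  simp [inner_add_left, inner_neg_left, inner_smul_left] at h1
  simpa [inner_smul_left] using h1

/-- The factor `(c ^ 2) ^ (d + 1)` from the Hessian determinant cancels the one from the norm of the
gradient, so no power of `c` survives. -/
theorem normalJacobian_antipodal_le (hK : IsSmoothBody K) {c : ℝ} (hc : 0 < c) {u : Sph d}
    (hle : ∀ y, gauge K (-y) ≤ c * gauge K y)
    (heq : gauge K (-(u : Euc d)) = c * gauge K u) :
    normalMap K (-u) = -normalMap K u ∧ normalJacobian K (-u) ≤ normalJacobian K u := by
  have hu := sphere_ne_zero u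
  have hnu : -(u : Euc d) ≠ 0 := neg_ne_zero.2 hu
  obtain ⟨hgrad, hhess⟩ := energyHess_antipodal_le hK hu hle heq
  have hV := hK.energyGrad_ne_zero hu
  have hVp := norm_pos_iff.2 hV
  have hc2 : 0 < c ^ 2 := by positivity
  constructor
  · rw [normalMap, normalMap, coe_neg_sphere, hgrad, direction_neg (smul_ne_zero hc2.ne' hV),
      direction_smul hc2 hV]
  · have hdet : (energyHess K (-(u : Euc d))).det ≤ (c ^ 2) ^ (d + 1) * (energyHess K u).det := by
      have h1 := det_le_det_of_inner (A := c ^ 2 • energyHess K u)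
        (fun v w => by
          simp only [smul_apply, inner_smul_left, inner_smul_right, hK.energyHess_symm hu v w]
          simp)
        (hK.energyHess_symm hnu) (hK.energyHess_nonneg hnu) hhess
      have h2 : (c ^ 2 • energyHess K u).det = (c ^ 2) ^ (d + 1) * (energyHess K u).det := by
        rw [ContinuousLinearMap.det, ContinuousLinearMap.toLinearMap_smul, LinearMap.det_smul]
        simp [ContinuousLinearMap.det]
      rwa [h2] at h1
    rw [normalJacobian, normalJacobian, coe_neg_sphere, hgrad, norm_neg, norm_smul,
      Real.norm_of_nonneg hc2.le, mul_pow, div_le_div_iff₀ (by positivity) (by positivity)]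
    calc _ ≤ (c ^ 2) ^ (d + 1) * (energyHess K u).det * ‖energyGrad K u‖ ^ (d + 1) := by gcongr
      _ = _ := by ring

end Comparison

/-! ### The support function in terms of the gauge. -/

section Support

variable {d : ℕ} {K : Set (Euc d)}

/-- The support function of a convex body in terms of its gauge. -/
def bodySupport (K : Set (Euc d)) (x : Sph d) : ℝ :=
  sSup (range fun u : Sph d => ⟪(u : Euc d), (x : Euc d)⟫ / gauge K u)

theorem inner_div_gauge_le_bodySupport (hK : IsCompact K) (hc : Convex ℝ K)
    (h0 : (0 : Euc d) ∈ interior K) (u x : Sph d) :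
    ⟪(u : Euc d), (x : Euc d)⟫ / gauge K u ≤ bodySupport K x := by
  have hcont : Continuous fun u : Sph d => ⟪(u : Euc d), (x : Euc d)⟫ / gauge K u :=
    Continuous.div (by fun_prop)
      ((continuous_gauge hc (mem_interior_iff_mem_nhds.1 h0)).comp continuous_subtype_val)
      fun u => (gauge_pos_of_ne hK h0 (sphere_ne_zero u)).ne'
  exact le_csSup (isCompact_range hcont).bddAbove (mem_range_self u)

theorem bodySupport_pos (hK : IsCompact K) (hc : Convex ℝ K)
    (h0 : (0 : Euc d) ∈ interior K) (x : Sph d) : 0 < bodySupport K x := by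
  refine lt_of_lt_of_le ?_ (inner_div_gauge_le_bodySupport hK hc h0 x x)
  rw [real_inner_self_eq_norm_sq, norm_sphere]
  have := gauge_pos_of_ne hK h0 (sphere_ne_zero x)
  positivity

theorem IsSmoothBody.bodySupport_normalMap (hK : IsSmoothBody K) (u : Sph d) :
    bodySupport K (normalMap K u) =
      ⟪(u : Euc d), (normalMap K u : Euc d)⟫ / gauge K u := by
  have hu := sphere_ne_zero u
  refine le_antisymm (csSup_le ⟨_, mem_range_self u⟩ ?_)
    (inner_div_gauge_le_bodySupport hK.compact hK.strictConvex.convex hK.zero_mem u _)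
  rintro _ ⟨v, rfl⟩
  have hV := hK.energyGrad_ne_zero hu
  have hVp := norm_pos_iff.2 hV
  have h1 := hK.inner_energyGrad_self hu
  have h2 := hK.inner_energyGrad_le hu (v : Euc d)
  have hju := hK.gauge_pos hu
  have hjv := hK.gauge_pos (sphere_ne_zero v)
  dsimp only
  rw [normalMap, coe_direction hV, inner_smul_right, inner_smul_right,
    real_inner_comm _ (v : Euc d), real_inner_comm _ (u : Euc d), h1, div_le_div_iff₀ hjv hju]
  have h3 : ⟪energyGrad K u, (v : Euc d)⟫ * gauge K u ≤ gauge K u ^ 2 * gauge K v := by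
    nlinarith
  calc _ = ‖energyGrad K u‖⁻¹ * (⟪energyGrad K u, (v : Euc d)⟫ * gauge K u) := by ring
    _ ≤ ‖energyGrad K u‖⁻¹ * (gauge K u ^ 2 * gauge K v) := by gcongr
    _ = _ := by ring

end Support

/-! ### The conserved integral, the monotone integral and the persistence of symmetry. -/

section Evolution

variable {d : ℕ} {f g : Sph d → ℝ} {T : EReal} {K : ℝ → Set (Euc d)}

/-- The time derivative of the logarithm of the gauge along the flow. -/
def logGaugeRate (f g : Sph d → ℝ) (K : Set (Euc d)) (u : Sph d) : ℝ :=
  f (normalMap K u) / g u * normalJacobian K u - 1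

theorem IsGaugeFlow.gauge_pos (hK : IsGaugeFlow f g T K) {t : ℝ} (ht : t ∈ timeInterval T)
    (u : Sph d) : 0 < gauge (K t) u :=
  gauge_pos_of_ne (hK.compact t ht) (hK.zero_mem t ht) (sphere_ne_zero u)

theorem IsGaugeFlow.hasDerivAt_log_gauge (hK : IsGaugeFlow f g T K) {t : ℝ}
    (ht : t ∈ timeInterval T) (h0 : 0 < t) (u : Sph d) :
    HasDerivAt (fun s => Real.log (gauge (K s) u)) (logGaugeRate f g (K t) u) t := by
  have hpos := hK.gauge_pos ht u
  have := (hK.evolution t ht h0 u).log hpos.ne'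
  rwa [mul_div_cancel_left₀ _ hpos.ne'] at this

theorem IsGaugeFlow.continuousOn_log_gauge (hK : IsGaugeFlow f g T K) {t : ℝ}
    (ht : t ∈ timeInterval T) :
    ContinuousOn (fun q : Sph d × ℝ => Real.log (gauge (K q.2) q.1)) (univ ×ˢ Icc 0 t) :=
  (hK.continuousOn t ht).log fun q hq => (hK.gauge_pos (Icc_subset_timeInterval ht hq.2) q.1).ne'

theorem IsGaugeFlow.continuous_log_gauge (hK : IsGaugeFlow f g T K) {t : ℝ}
    (ht : t ∈ timeInterval T) : Continuous fun u : Sph d => Real.log (gauge (K t) u) :=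
  (hK.continuousOn_log_gauge ht).comp_continuous (f := fun u : Sph d => (u, t)) (by fun_prop)
    fun _ => ⟨mem_univ _, ht.1, le_rfl⟩

/-- The weights serve two uses: `φ = id` for the conserved integral, and `φ` a frozen inverse Gauss
map for the barrier of the support integral. -/
theorem IsGaugeFlow.hasDerivAt_integral_log_gauge (hK : IsGaugeFlow f g T K) {a c : Sph d → ℝ}
    {φ : Sph d → Sph d} (ha : Continuous a) (hc : Continuous c) (hφ : Continuous φ) {t : ℝ}
    (ht : t ∈ timeInterval T) (h0 : 0 < t) :
    HasDerivAt (fun s => ∫ y, (a y + c y * Real.log (gauge (K s) (φ y))) ∂(sphereMeasure d))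
      (∫ y, c y * logGaugeRate f g (K t) (φ y) ∂(sphereMeasure d)) t := by
  set S : Set ℝ := timeInterval T ∩ Ioi 0 with hS
  have hSt : S ∈ 𝓝 t := Filter.inter_mem (timeInterval_mem_nhds ht h0) (Ioi_mem_nhds h0)
  set G : Euc d × ℝ → ℝ := fun q => gauge (K q.2) q.1 with hG
  have hGd : ∀ z : Euc d, z ≠ 0 → ∀ s ∈ S,
      HasDerivAt (fun r => gauge (K r) z) (fderiv ℝ G (z, s) (0, 1)) s := by
    intro z hz s hs
    exact HasFDerivAt.comp_hasDerivAt (f := fun r => (z, r)) s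
      ((hK.smooth s hs.1 hs.2 z hz).differentiableAt (by simp)).hasFDerivAt
      ((hasDerivAt_const s _).prodMk (hasDerivAt_id s))
  have hGc : ContinuousOn (fun q : Sph d × ℝ =>
      fderiv ℝ G ((φ q.1 : Euc d), q.2) (0, 1)) (univ ×ˢ S) := by
    rintro ⟨u, s⟩ ⟨-, hs⟩
    have h1 : ContinuousAt (fderiv ℝ G) ((φ u : Euc d), s) :=
      ((hK.smooth s hs.1 hs.2 _ (sphere_ne_zero (φ u))).fderiv_right (m := 1)
        (by norm_num)).continuousAt
    have h2 : ContinuousAt (fun q : Sph d × ℝ => fderiv ℝ G ((φ q.1 : Euc d), q.2)) (u, s) :=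
      ContinuousAt.comp (f := fun q : Sph d × ℝ => ((φ q.1 : Euc d), q.2)) (x := (u, s)) h1
        (by fun_prop)
    exact (h2.clm_apply continuousAt_const).continuousWithinAt
  have hJc : ContinuousOn (fun q : Sph d × ℝ => gauge (K q.2) (φ q.1)) (univ ×ˢ S) := by
    rintro ⟨u, s⟩ ⟨-, hs⟩
    have h1 : ContinuousAt G ((φ u : Euc d), s) :=
      (hK.smooth s hs.1 hs.2 _ (sphere_ne_zero (φ u))).continuousAt
    exact (ContinuousAt.comp (f := fun q : Sph d × ℝ => ((φ q.1 : Euc d), q.2)) (x := (u, s)) h1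
      (by fun_prop)).continuousWithinAt
  have key := hasDerivAt_integral_of_continuousOn (μ := sphereMeasure d)
    (F := fun y s => a y + c y * Real.log (gauge (K s) (φ y)))
    (F' := fun y s => c y * (fderiv ℝ G ((φ y : Euc d), s) (0, 1) / gauge (K s) (φ y))) hSt
    (fun s hs => ha.add (hc.mul ((hK.continuous_log_gauge hs.1).comp hφ)))
    ((hc.comp continuous_fst).continuousOn.mul (hGc.div hJc fun q hq =>
      (hK.gauge_pos hq.2.1 _).ne'))
    (fun y s hs => (((hGd _ (sphere_ne_zero (φ y)) s hs).log
      (hK.gauge_pos hs.1 _).ne').const_mul (c y)).const_add (a y))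
  -- Joint regularity supplied a continuous time derivative to dominate with; the evolution equation
  -- now identifies its value.
  convert! key using 1
  refine integral_congr_ae (Filter.Eventually.of_forall fun y => ?_)
  have h1 := (hK.evolution t ht h0 (φ y)).unique (hGd _ (sphere_ne_zero (φ y)) t ⟨ht, h0⟩)
  simp only
  rw [← h1, mul_div_cancel_left₀ _ (hK.gauge_pos ht _).ne']
  rfl

theorem integrable_of_continuous {F : Sph d → ℝ} (hF : Continuous F) :
    Integrable F (sphereMeasure d) :=
  hF.integrable_of_hasCompactSupport (HasCompactSupport.of_compactSpace _)

theorem IsGaugeFlow.integral_log_gauge_eq (hK : IsGaugeFlow f g T K) (hf : Continuous f)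
    (hg : Continuous g) (hg_pos : ∀ u, 0 < g u)
    (hfg : ∫ x, f x ∂(sphereMeasure d) = ∫ u, g u ∂(sphereMeasure d)) {t : ℝ}
    (ht : t ∈ timeInterval T) :
    ∫ u, g u * Real.log (gauge (K t) u) ∂(sphereMeasure d) =
      ∫ u, g u * Real.log (gauge (K 0) u) ∂(sphereMeasure d) := by
  have hcont : ContinuousOn
      (fun s => ∫ u, g u * Real.log (gauge (K s) u) ∂(sphereMeasure d)) (Icc 0 t) :=
    continuousOn_integral_of_continuousOn isCompact_Icc
      ((hg.comp continuous_fst).continuousOn.mul (hK.continuousOn_log_gauge ht))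
  have hderiv : ∀ s ∈ Ioc 0 t, HasDerivAt
      (fun s => ∫ u, g u * Real.log (gauge (K s) u) ∂(sphereMeasure d)) 0 s := by
    intro s hs
    have hsI := Icc_subset_timeInterval ht (Ioc_subset_Icc_self hs)
    have h := hK.hasDerivAt_integral_log_gauge (a := fun _ => 0) (c := g) (φ := id)
      continuous_const hg continuous_id hsI hs.1
    simp only [zero_add, id] at h
    convert! h using 1
    have hb := hK.isSmoothBody hsI hs.1
    have h1 := hb.integral_normalMap hf
    have h2 : ∀ u, g u * logGaugeRate f g (K s) u =
        normalJacobian (K s) u * f (normalMap (K s) u) - g u := by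
      intro u
      have := (hg_pos u).ne'
      rw [logGaugeRate]
      field_simp
    simp_rw [h2]
    have hi : Integrable (fun u => normalJacobian (K s) u * f (normalMap (K s) u))
        (sphereMeasure d) := integrable_of_continuous (hb.continuous_normalJacobian.mul
      (hf.comp hb.continuous_normalMap))
    rw [integral_sub hi (integrable_of_continuous hg), h1, hfg, sub_self]
  refine le_antisymm ?_ ?_
  · exact le_of_lower_barrier ht.1 hcont fun s hs =>
      ⟨_, 0, hderiv s hs, le_rfl, rfl, fun _ _ => le_rfl⟩
  · have := le_of_lower_barrier ht.1 hcont.neg fun s hs =>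
      ⟨_, _, (hderiv s hs).neg, by simp, rfl, fun _ _ => le_rfl⟩
    simpa using this

theorem IsGaugeFlow.continuousOn_bodySupport (hK : IsGaugeFlow f g T K) {t : ℝ}
    (ht : t ∈ timeInterval T) :
    ContinuousOn (fun q : Sph d × ℝ => bodySupport (K q.2) q.1) (univ ×ˢ Icc 0 t) := by
  refine continuousOn_sSup_of_continuousOn (Y := Sph d) (Z := Sph d × ℝ)
    (F := fun q u => ⟪(u : Euc d), (q.1 : Euc d)⟫ / gauge (K q.2) u) ?_
  refine ContinuousOn.div (by fun_prop) ?_ ?_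
  · exact (hK.continuousOn t ht).comp (f := fun q : Sph d × (Sph d × ℝ) => (q.1, q.2.2))
      (by fun_prop) fun q hq => ⟨mem_univ _, hq.2.2⟩
  · exact fun q hq => (hK.gauge_pos (Icc_subset_timeInterval ht hq.2.2) q.1).ne'

theorem IsGaugeFlow.bodySupport_pos (hK : IsGaugeFlow f g T K) {t : ℝ}
    (ht : t ∈ timeInterval T) (x : Sph d) : 0 < bodySupport (K t) x :=
  GaussFlow.bodySupport_pos (hK.compact t ht) (hK.strictConvex t ht).convex (hK.zero_mem t ht) x

theorem IsGaugeFlow.continuousOn_log_bodySupport (hK : IsGaugeFlow f g T K) {t : ℝ}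
    (ht : t ∈ timeInterval T) :
    ContinuousOn (fun q : Sph d × ℝ => Real.log (bodySupport (K q.2) q.1)) (univ ×ˢ Icc 0 t) :=
  (hK.continuousOn_bodySupport ht).log fun q hq =>
    (hK.bodySupport_pos (Icc_subset_timeInterval ht hq.2) q.1).ne'

theorem IsGaugeFlow.continuous_log_bodySupport (hK : IsGaugeFlow f g T K) {t : ℝ}
    (ht : t ∈ timeInterval T) : Continuous fun x : Sph d => Real.log (bodySupport (K t) x) :=
  (hK.continuousOn_log_bodySupport ht).comp_continuous (f := fun u : Sph d => (u, t))
    (by fun_prop) fun _ => ⟨mem_univ _, ht.1, le_rfl⟩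

/-- After the substitution `x = N u`, with `k` the Jacobian and `y = f (N u)`, the integrand is `(k
y) ^ 2 / g - k y`, and `(k y) ^ 2 / g ≥ 2 k y - g`. All first-order terms cancel since `∫ k y = ∫ f
= ∫ g`. -/
theorem IsGaugeFlow.integral_rate_nonneg {K : Set (Euc d)} (hK : IsSmoothBody K)
    (hf : Continuous f) (hg : Continuous g) (hg_pos : ∀ u, 0 < g u)
    (hfg : ∫ x, f x ∂(sphereMeasure d) = ∫ u, g u ∂(sphereMeasure d)) :
    0 ≤ ∫ x, f x * logGaugeRate f g K ((normalHomeo hK).symm x) ∂(sphereMeasure d) := by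
  set ψ := (normalHomeo hK).symm with hψ
  have hN : ∀ x, normalMap K (ψ x) = x := fun x => (normalHomeo hK).apply_symm_apply x
  have hN' : ∀ u, ψ (normalMap K u) = u := fun u => (normalHomeo hK).symm_apply_apply u
  have hκ := hK.continuous_normalJacobian
  set F : Sph d → ℝ := fun x => f x ^ 2 / g (ψ x) * normalJacobian K (ψ x) with hF
  have hFc : Continuous F :=
    ((hf.pow 2).div (hg.comp ψ.continuous) fun x => (hg_pos _).ne').mul (hκ.comp ψ.continuous)
  have h1 : ∀ x, f x * logGaugeRate f g K (ψ x) = F x - f x := by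
    intro x
    simp only [hF, logGaugeRate, hN]
    ring
  simp_rw [h1]
  rw [integral_sub (integrable_of_continuous hFc) (integrable_of_continuous hf),
    ← hK.integral_normalMap hFc]
  have hNc := hf.comp hK.continuous_normalMap
  have h2 : ∫ u, (2 * (normalJacobian K u * f (normalMap K u)) - g u) ∂(sphereMeasure d) ≤
      ∫ u, normalJacobian K u * F (normalMap K u) ∂(sphereMeasure d) := by
    refine integral_mono (integrable_of_continuous ((continuous_const.mul (hκ.mul hNc)).sub hg))
      (integrable_of_continuous (hκ.mul (hFc.comp hK.continuous_normalMap))) fun u => ?_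
    have hgu := hg_pos u
    simp only [hF, hN']
    set k := normalJacobian K u
    set y := f (normalMap K u)
    have : k * (y ^ 2 / g u * k) - (2 * (k * y) - g u) = (k * y - g u) ^ 2 / g u := by
      field_simp
      ring
    have h3 : 0 ≤ (k * y - g u) ^ 2 / g u := by positivity
    linarith
  have hi : Integrable (fun u => 2 * (normalJacobian K u * f (normalMap K u))) (sphereMeasure d) :=
    integrable_of_continuous (continuous_const.mul (hκ.mul hNc))
  rw [integral_sub hi (integrable_of_continuous hg), integral_const_mul, hK.integral_normalMap hf, ← hfg] at h2
  linarith

theorem IsGaugeFlow.integral_log_bodySupport_le (hK : IsGaugeFlow f g T K) (hf : Continuous f)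
    (hf_pos : ∀ x, 0 < f x) (hg : Continuous g) (hg_pos : ∀ u, 0 < g u)
    (hfg : ∫ x, f x ∂(sphereMeasure d) = ∫ u, g u ∂(sphereMeasure d)) {t : ℝ}
    (ht : t ∈ timeInterval T) :
    ∫ x, f x * Real.log (bodySupport (K t) x) ∂(sphereMeasure d) ≤
      ∫ x, f x * Real.log (bodySupport (K 0) x) ∂(sphereMeasure d) := by
  have hcont : ContinuousOn
      (fun s => ∫ x, f x * Real.log (bodySupport (K s) x) ∂(sphereMeasure d)) (Icc 0 t) :=
    continuousOn_integral_of_continuousOn isCompact_Icc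
      ((hf.comp continuous_fst).continuousOn.mul (hK.continuousOn_log_bodySupport ht))
  refine le_of_lower_barrier ht.1 hcont fun s hs => ?_
  have hsI := Icc_subset_timeInterval ht (Ioc_subset_Icc_self hs)
  have hb := hK.isSmoothBody hsI hs.1
  set ψ := (normalHomeo hb).symm with hψ
  have hN : ∀ x, normalMap (K s) (ψ x) = x := fun x => (normalHomeo hb).apply_symm_apply x
  have hsupp : ∀ x, bodySupport (K s) x = ⟪(ψ x : Euc d), (x : Euc d)⟫ / gauge (K s) (ψ x) := by
    intro x
    have := hb.bodySupport_normalMap (ψ x)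
    rwa [hN] at this
  have hin : ∀ x, 0 < ⟪(ψ x : Euc d), (x : Euc d)⟫ := by
    intro x
    have h1 := hK.bodySupport_pos hsI x
    rw [hsupp] at h1
    exact (div_pos_iff_of_pos_right (hK.gauge_pos hsI _)).1 h1
  -- The barrier replaces the support value at each `x` by the contribution of the boundary point in
  -- the fixed direction `ψ x`, which realises the maximum at time `s`.
  set a : Sph d → ℝ := fun x => f x * Real.log ⟪(ψ x : Euc d), (x : Euc d)⟫ with ha
  have hac : Continuous a := by
    refine hf.mul (Continuous.log ?_ fun x => (hin x).ne')
    have := ψ.continuous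
    fun_prop
  have hd := hK.hasDerivAt_integral_log_gauge (a := a) (c := fun x => -f x) (φ := ψ) hac hf.neg
    ψ.continuous hsI hs.1
  have hlog : ∀ r ∈ timeInterval T, ∀ x, a x + -f x * Real.log (gauge (K r) (ψ x)) =
      f x * Real.log (⟪(ψ x : Euc d), (x : Euc d)⟫ / gauge (K r) (ψ x)) := by
    intro r hr x
    rw [Real.log_div (hin x).ne' (hK.gauge_pos hr _).ne']
    simp only [ha]
    ring
  refine ⟨_, _, hd, ?_, ?_, ?_⟩
  · have := IsGaugeFlow.integral_rate_nonneg hb hf hg hg_pos hfg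
    simp only [neg_mul, integral_neg]
    linarith
  · refine integral_congr_ae (Filter.Eventually.of_forall fun x => ?_)
    simp only
    rw [hlog s hsI, hsupp]
  · intro r hr
    have hrI := Icc_subset_timeInterval ht ⟨hr.1.le, hr.2.le.trans hs.2⟩
    refine integral_mono (integrable_of_continuous (hac.add (hf.neg.mul
      ((hK.continuous_log_gauge hrI).comp ψ.continuous))))
      (integrable_of_continuous (hf.mul (hK.continuous_log_bodySupport hrI))) fun x => ?_
    simp only
    rw [hlog r hrI]
    refine mul_le_mul_of_nonneg_left (Real.log_le_log ?_ ?_) (hf_pos x).le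
    · exact div_pos (hin x) (hK.gauge_pos hrI _)
    · exact inner_div_gauge_le_bodySupport (hK.compact r hrI) (hK.strictConvex r hrI).convex
        (hK.zero_mem r hrI) _ _

theorem gauge_neg_le_of_sphere {L : Set (Euc d)} {c : ℝ}
    (h : ∀ v : Sph d, gauge L (-(v : Euc d)) ≤ c * gauge L v) (y : Euc d) :
    gauge L (-y) ≤ c * gauge L y := by
  by_cases hy : y = 0
  · simp [hy, gauge_zero]
  have h1 := h (direction y)
  have h2 := mul_le_mul_of_nonneg_left h1 (norm_nonneg y)
  rw [← gauge_pos_smul _ (norm_nonneg y), smul_neg, norm_smul_direction hy, mul_left_comm,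
    ← gauge_pos_smul _ (norm_nonneg y), norm_smul_direction hy] at h2
  exact h2

theorem IsGaugeFlow.gauge_neg (hK : IsGaugeFlow f g T K) (hf_pos : ∀ x, 0 < f x)
    (hg_pos : ∀ u, 0 < g u) (hf_even : ∀ x, f (-x) = f x) (hg_even : ∀ x, g (-x) = g x)
    (hsymm : ∀ u : Sph d, gauge (K 0) (-(u : Euc d)) = gauge (K 0) u) {t : ℝ}
    (ht : t ∈ timeInterval T) (y : Euc d) : gauge (K t) (-y) = gauge (K t) y := by
  set φ : ℝ → Sph d → ℝ := fun s u =>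
    Real.log (gauge (K s) ((-u : Sph d) : Euc d)) - Real.log (gauge (K s) u) with hφ
  have hφc : ContinuousOn (fun q : Sph d × ℝ => φ q.2 q.1) (univ ×ˢ Icc 0 t) :=
    ((hK.continuousOn_log_gauge ht).comp (f := fun q : Sph d × ℝ => (-q.1, q.2)) (by fun_prop)
      fun q hq => ⟨mem_univ _, hq.2⟩).sub (hK.continuousOn_log_gauge ht)
  have hφs : ∀ s ∈ Icc 0 t, Continuous (φ s) := fun s hs =>
    hφc.comp_continuous (f := fun u : Sph d => (u, s)) (by fun_prop) fun _ => ⟨mem_univ _, hs⟩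
  have hle : ∀ s ∈ Icc 0 t, ∀ u, φ s u ≤ sSup (range (φ s)) := fun s hs u =>
    le_csSup (isCompact_range (hφs s hs)).bddAbove (mem_range_self u)
  have : Nonempty (Sph d) := ⟨direction 0⟩
  have key : sSup (range (φ t)) ≤ sSup (range (φ 0)) := by
    refine le_of_lower_barrier ht.1 (continuousOn_sSup_of_continuousOn hφc) fun s hs => ?_
    have hsI := Icc_subset_timeInterval ht (Ioc_subset_Icc_self hs)
    have hb := hK.isSmoothBody hsI hs.1
    -- The barrier for the maximum is the same quantity followed at a fixed maximum point `u`.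
    obtain ⟨u, hu⟩ := (isCompact_range (hφs s (Ioc_subset_Icc_self hs))).sSup_mem (range_nonempty _)
    have hd := (hK.hasDerivAt_log_gauge hsI hs.1 (-u)).sub (hK.hasDerivAt_log_gauge hsI hs.1 u)
    refine ⟨fun r => φ r u, _, hd, ?_, hu, fun r hr => hle r ⟨hr.1.le, hr.2.le.trans hs.2⟩ u⟩
    set c := Real.exp (φ s u) with hc
    have hcv : ∀ v : Sph d, gauge (K s) ((-v : Sph d) : Euc d) =
        Real.exp (φ s v) * gauge (K s) v := by
      intro v
      simp only [hφ]
      rw [Real.exp_sub, Real.exp_log (hK.gauge_pos hsI _), Real.exp_log (hK.gauge_pos hsI _),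
        div_mul_cancel₀ _ (hK.gauge_pos hsI _).ne']
    -- Maximality at `u` says that the gauge of `-v` is at most `Real.exp (φ s u)` times the gauge
    -- of `v`, with equality at `u`.
    have hneg := normalJacobian_antipodal_le hb (Real.exp_pos (φ s u)) (u := u)
      (gauge_neg_le_of_sphere fun v => by
        rw [← coe_neg_sphere, hcv v]
        refine mul_le_mul_of_nonneg_right (Real.exp_le_exp.2 ?_) (gauge_nonneg _)
        rw [hu]
        exact hle s (Ioc_subset_Icc_self hs) v)
      (by rw [← coe_neg_sphere, hcv u])
    rw [logGaugeRate, logGaugeRate, hneg.1, hf_even, hg_even]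
    have h1 : 0 ≤ f (normalMap (K s) u) / g u := (div_pos (hf_pos _) (hg_pos _)).le
    nlinarith [mul_le_mul_of_nonneg_left hneg.2 h1]
  have h0 : sSup (range (φ 0)) = 0 := by
    have : φ 0 = fun _ => 0 := by
      funext u
      simp only [hφ, coe_neg_sphere, hsymm, sub_self]
    rw [this, range_const, csSup_singleton]
  have hle1 : ∀ z, gauge (K t) (-z) ≤ gauge (K t) z := by
    intro z
    have := gauge_neg_le_of_sphere (L := K t) (c := 1) (fun v => by
      have h1 := (hle t ⟨ht.1, le_rfl⟩ v).trans (key.trans h0.le)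
      simp only [hφ, sub_nonpos] at h1
      rw [one_mul, ← coe_neg_sphere]
      exact (Real.log_le_log_iff (hK.gauge_pos ht _) (hK.gauge_pos ht _)).1 h1) z
    rwa [one_mul] at this
  refine le_antisymm (hle1 y) ?_
  have := hle1 (-y)
  rwa [neg_neg] at this

end Evolution

/-! ### Uniform integrability of the logarithm of a coordinate on the sphere. -/

section LogIntegral

variable {d : ℕ}

/-- The negative part of the logarithm of a coordinate on the unit ball. -/
def ballLog (y : Euc d) (a : ℝ) : ENNReal :=
  if ‖y‖ < 1 then ENNReal.ofReal (-Real.log |a|) else 0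

/-- The ball lies in the cube `[-1, 1] ^ (d + 1)`, where the integrand is dominated by a product of
one-variable integrable functions. -/
theorem lintegral_ballLog_coord_lt_top : ∫⁻ w : Euc d, ballLog w (w 0) < ⊤ := by
  set F : Fin (d + 1) → ℝ → ℝ := fun i =>
    (Icc (-1 : ℝ) 1).indicator fun t => if i = 0 then |Real.log t| else 1 with hF
  have hFi : ∀ i, Integrable (F i) := by
    intro i
    rw [hF, integrable_indicator_iff measurableSet_Icc]
    by_cases hi : i = 0
    · simp only [hi, if_true]
      have h := (intervalIntegral.intervalIntegrable_log' (a := -1) (b := 1)).abs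
      rwa [intervalIntegrable_iff_integrableOn_Icc_of_le (by norm_num)] at h
    · simp only [hi, if_false]
      exact integrableOn_const (by simp)
  have hint : Integrable (fun v : Fin (d + 1) → ℝ => ∏ i, F i (v i)) := Integrable.fintype_prod hFi
  have hle : ∀ w : Euc d, ballLog w (w 0) ≤ ‖∏ i, F i (w i)‖ₑ := by
    intro w
    rw [ballLog]
    split_ifs with hw
    · have hmem : ∀ i, w i ∈ Icc (-1 : ℝ) 1 := by
        intro i
        have := (PiLp.norm_apply_le w i).trans hw.le
        rwa [Real.norm_eq_abs, abs_le] at this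
      have : ∏ i, F i (w i) = |Real.log (w 0)| := by
        rw [Fin.prod_univ_succ]
        simp [hF, indicator_of_mem (hmem _)]
      rw [this, ← ofReal_norm, Real.norm_eq_abs, abs_abs, Real.log_abs]
      exact ENNReal.ofReal_le_ofReal (neg_le_abs _)
    · exact zero_le
  refine lt_of_le_of_lt (lintegral_mono hle) ?_
  have h := (PiLp.volume_preserving_ofLp (Fin (d + 1))).lintegral_comp_emb
    (MeasurableEquiv.toLp 2 (Fin (d + 1) → ℝ)).symm.measurableEmbedding
    (fun v => ‖∏ i, F i (v i)‖ₑ)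
  rw [show ∫⁻ w : Euc d, ‖∏ i, F i (w i)‖ₑ = _ from h]
  exact hint.2

/-- Rotation invariance of Lebesgue measure; this makes the later bound uniform in `u`. -/
theorem lintegral_ballLog_inner (u : Sph d) :
    ∫⁻ y : Euc d, ballLog y ⟪y, (u : Euc d)⟫ = ∫⁻ w : Euc d, ballLog w (w 0) := by
  have hon : Orthonormal ℝ (({0} : Set (Fin (d + 1))).domRestrict fun _ => (u : Euc d)) := by
    constructor
    · intro i; exact norm_sphere u
    · intro i j hij
      exact absurd (Subtype.ext (i.2.trans j.2.symm)) hij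
  obtain ⟨b, hb⟩ := hon.exists_orthonormalBasis_extension_of_card_eq (by simp)
  have hb0 : b 0 = (u : Euc d) := hb 0 rfl
  have h := b.measurePreserving_repr.lintegral_comp_emb
    b.repr.toHomeomorph.measurableEmbedding (fun w : Euc d => ballLog w (w 0))
  rw [← h]
  refine lintegral_congr fun y => ?_
  rw [ballLog, ballLog, b.repr.norm_map, b.repr_apply_apply, hb0, real_inner_comm]

theorem measurable_ballLog (u : Sph d) :
    Measurable fun y : Euc d => ballLog y ⟪y, (u : Euc d)⟫ := by
  refine Measurable.ite (measurableSet_lt measurable_norm measurable_const) ?_ measurable_const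
  exact ENNReal.measurable_ofReal.comp (Real.measurable_log.comp
    (by fun_prop : Measurable fun y : Euc d => |⟪y, (u : Euc d)⟫|)).neg

theorem abs_inner_sphere_le_one (x u : Sph d) : |⟪(x : Euc d), (u : Euc d)⟫| ≤ 1 := by
  have := abs_real_inner_le_norm (x : Euc d) (u : Euc d)
  rwa [norm_sphere, norm_sphere, mul_one] at this

/-- For `r < 1` the point `r x` has smaller inner product with `u` in absolute value than `x`, so
the sphere integrand is bounded by the ball integrand on each ray. -/
theorem lintegral_neg_log_inner_le (u : Sph d) :
    (∫⁻ x : Sph d, ENNReal.ofReal (-Real.log |⟪(x : Euc d), (u : Euc d)⟫|) ∂(sphereMeasure d)) *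
      ENNReal.ofReal ((d + 1 : ℝ)⁻¹) ≤ ∫⁻ w : Euc d, ballLog w (w 0) := by
  rw [← lintegral_ballLog_inner u, lintegral_polar (measurable_ballLog u),
    ← lintegral_mul_const' _ _ ENNReal.ofReal_ne_top]
  refine lintegral_mono fun x => ?_
  have h := lintegral_indicator_radial (d := d)
    (ENNReal.ofReal (-Real.log |⟪(x : Euc d), (u : Euc d)⟫|)) one_pos
  simp only [one_pow, inv_one, one_div, mul_one] at h
  rw [← h]
  refine lintegral_mono fun r => ?_
  have hr : (0 : ℝ) < r := r.2
  simp only [ballLog, norm_smul, norm_sphere, Real.norm_of_nonneg hr.le, mul_one]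
  split_ifs with h1
  · refine ENNReal.ofReal_le_ofReal (neg_le_neg ?_)
    rw [inner_smul_left, conj_trivial]
    -- Where the inner product vanishes both logarithms take the default value `0`.
    by_cases h0 : ⟪(x : Euc d), (u : Euc d)⟫ = 0
    · simp [h0]
    · rw [abs_mul, abs_of_pos hr]
      exact Real.log_le_log (mul_pos hr (abs_pos.2 h0)) (mul_le_of_le_one_left (abs_nonneg _) h1.le)
  · exact le_rfl

theorem ae_inner_ne_zero (u : Sph d) :
    ∀ᵐ x : Sph d ∂(sphereMeasure d), ⟪(x : Euc d), (u : Euc d)⟫ ≠ 0 := by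
  have hs : MeasurableSet {x : Sph d | ⟪(x : Euc d), (u : Euc d)⟫ = 0} :=
    measurableSet_eq_fun (by fun_prop) measurable_const
  rw [ae_iff]
  simp only [not_not]
  rw [sphereMeasure, Measure.toSphere_apply' _ hs]
  have hnull : (volume : Measure (Euc d)) ((ℝ ∙ (u : Euc d))ᗮ : Submodule ℝ (Euc d)) = 0 := by
    refine Measure.addHaar_submodule _ _ fun htop => ?_
    have : (u : Euc d) ∈ (ℝ ∙ (u : Euc d))ᗮ := by rw [htop]; trivial
    rw [Submodule.mem_orthogonal_singleton_iff_inner_right, real_inner_self_eq_norm_sq,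
      norm_sphere] at this
    norm_num at this
  refine mul_eq_zero_of_right _ (measure_mono_null ?_ hnull)
  rintro _ ⟨r, -, _, ⟨x, hx, rfl⟩, rfl⟩
  have hx : ⟪(x : Euc d), (u : Euc d)⟫ = 0 := hx
  change r • (x : Euc d) ∈ (ℝ ∙ (u : Euc d))ᗮ
  rw [Submodule.mem_orthogonal_singleton_iff_inner_left, inner_smul_left, hx, mul_zero]

theorem exists_integral_neg_log_inner_le (d : ℕ) : ∃ L : ℝ, ∀ u : Sph d,
    Integrable (fun x : Sph d => Real.log |⟪(x : Euc d), (u : Euc d)⟫|) (sphereMeasure d) ∧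
      ∫ x : Sph d, -Real.log |⟪(x : Euc d), (u : Euc d)⟫| ∂(sphereMeasure d) ≤ L := by
  set c := ENNReal.ofReal ((d + 1 : ℝ)⁻¹) with hc
  have hc0 : c ≠ 0 := by
    rw [hc, Ne, ENNReal.ofReal_eq_zero, not_le]
    positivity
  set B := (∫⁻ w : Euc d, ballLog w (w 0)) / c with hB
  have hBtop : B ≠ ⊤ := (ENNReal.div_lt_top lintegral_ballLog_coord_lt_top.ne hc0).ne
  refine ⟨B.toReal, fun u => ?_⟩
  have hnn : ∀ x : Sph d, 0 ≤ -Real.log |⟪(x : Euc d), (u : Euc d)⟫| := fun x =>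
    neg_nonneg.2 (Real.log_nonpos (abs_nonneg _) (abs_inner_sphere_le_one x u))
  have hm : Measurable fun x : Sph d => -Real.log |⟪(x : Euc d), (u : Euc d)⟫| :=
    (Real.measurable_log.comp
      (by fun_prop : Measurable fun x : Sph d => |⟪(x : Euc d), (u : Euc d)⟫|)).neg
  have hle : ∫⁻ x : Sph d, ENNReal.ofReal (-Real.log |⟪(x : Euc d), (u : Euc d)⟫|)
      ∂(sphereMeasure d) ≤ B := by
    rw [hB, ENNReal.le_div_iff_mul_le (Or.inl hc0) (Or.inl ENNReal.ofReal_ne_top)]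
    exact lintegral_neg_log_inner_le u
  have hint : Integrable (fun x : Sph d => -Real.log |⟪(x : Euc d), (u : Euc d)⟫|)
      (sphereMeasure d) := by
    refine ⟨hm.aestronglyMeasurable, ?_⟩
    rw [hasFiniteIntegral_iff_ofReal (Filter.Eventually.of_forall hnn)]
    exact lt_of_le_of_lt hle hBtop.lt_top
  refine ⟨by simpa using hint.neg, ?_⟩
  rw [integral_eq_lintegral_of_nonneg_ae (Filter.Eventually.of_forall hnn) hm.aestronglyMeasurable]
  exact ENNReal.toReal_mono hBtop hle

/-- Since the logarithm is nonpositive and `φ ≤ M`, one has `s φ + M log ≤ φ (s + log) ≤ φ ψ`. The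
hypothesis omits the null set where the inner product vanishes, as the default value of the
logarithm there is useless. -/
theorem mul_integral_sub_le_of_log_inner_le {L : ℝ} {u : Sph d}
    (hint : Integrable (fun x : Sph d => Real.log |⟪(x : Euc d), (u : Euc d)⟫|) (sphereMeasure d))
    (hL : ∫ x : Sph d, -Real.log |⟪(x : Euc d), (u : Euc d)⟫| ∂(sphereMeasure d) ≤ L)
    {φ ψ : Sph d → ℝ} (hφ : Continuous φ) (hψ : Continuous ψ) (hφ0 : ∀ x, 0 < φ x) {M : ℝ}
    (hM0 : 0 ≤ M) (hM : ∀ x, φ x ≤ M) {s : ℝ}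
    (h : ∀ x : Sph d, ⟪(x : Euc d), (u : Euc d)⟫ ≠ 0 →
      s + Real.log |⟪(x : Euc d), (u : Euc d)⟫| ≤ ψ x) :
    s * ∫ x, φ x ∂(sphereMeasure d) - M * L ≤ ∫ x, φ x * ψ x ∂(sphereMeasure d) := by
  have h1 : ∫ x : Sph d, (s * φ x + M * Real.log |⟪(x : Euc d), (u : Euc d)⟫|) ∂(sphereMeasure d) ≤
      ∫ x, φ x * ψ x ∂(sphereMeasure d) := by
    refine integral_mono_ae (((integrable_of_continuous hφ).const_mul s).add (hint.const_mul M))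
      (integrable_of_continuous (hφ.mul hψ)) ?_
    filter_upwards [ae_inner_ne_zero u] with x hx
    have h2 := mul_le_mul_of_nonneg_left (h x hx) (hφ0 x).le
    have h3 : Real.log |⟪(x : Euc d), (u : Euc d)⟫| ≤ 0 :=
      Real.log_nonpos (abs_nonneg _) (abs_inner_sphere_le_one x u)
    nlinarith [hM x]
  rw [integral_add ((integrable_of_continuous hφ).const_mul s) (hint.const_mul M),
    integral_const_mul, integral_const_mul] at h1
  rw [integral_neg] at hL
  nlinarith

end LogIntegral

/-! ### Relations between radial function, support function and gauge. -/

section Estimates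

variable {d : ℕ} {K : Set (Euc d)}

theorem radialFn_frontier (hK : IsCompact K) (hc : Convex ℝ K) (h0 : (0 : Euc d) ∈ interior K)
    (u : Sph d) : radialFn (frontier K) u = (gauge K u)⁻¹ := by
  have hpos := gauge_pos_of_ne hK h0 (sphere_ne_zero u)
  have : {r : ℝ | 0 < r ∧ r • (u : Euc d) ∈ frontier K} = {(gauge K u)⁻¹} := by
    ext r
    simp only [mem_ofPred_eq, mem_singleton_iff]
    constructor
    · rintro ⟨hr, hmem⟩
      rw [← gauge_eq_one_iff_mem_frontier hc (mem_interior_iff_mem_nhds.1 h0),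
        gauge_pos_smul _ hr.le] at hmem
      exact eq_inv_of_mul_eq_one_left hmem
    · rintro rfl
      refine ⟨inv_pos.2 hpos, ?_⟩
      rw [← gauge_eq_one_iff_mem_frontier hc (mem_interior_iff_mem_nhds.1 h0),
        gauge_pos_smul _ (inv_pos.2 hpos).le, inv_mul_cancel₀ hpos.ne']
  rw [radialFn, this, csSup_singleton]

theorem supportFn_frontier (hK : IsCompact K) (hc : Convex ℝ K) (h0 : (0 : Euc d) ∈ interior K)
    (x : Sph d) : supportFn (frontier K) x = bodySupport K x := by
  rw [supportFn, bodySupport]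
  congr 1
  ext a
  simp only [mem_image, mem_range]
  constructor
  · rintro ⟨y, hy, rfl⟩
    rw [← gauge_eq_one_iff_mem_frontier hc (mem_interior_iff_mem_nhds.1 h0)] at hy
    have hy0 : y ≠ 0 := by
      rintro rfl
      rw [gauge_zero] at hy
      exact zero_ne_one hy
    have hn := norm_pos_iff.2 hy0
    refine ⟨direction y, ?_⟩
    rw [coe_direction hy0, gauge_pos_smul _ (by positivity), hy, inner_smul_left]
    simp only [conj_trivial]
    field_simp
  · rintro ⟨u, rfl⟩
    have hpos := gauge_pos_of_ne hK h0 (sphere_ne_zero u)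
    refine ⟨(gauge K u)⁻¹ • (u : Euc d), ?_, ?_⟩
    · rw [← gauge_eq_one_iff_mem_frontier hc (mem_interior_iff_mem_nhds.1 h0),
        gauge_pos_smul _ (inv_pos.2 hpos).le, inv_mul_cancel₀ hpos.ne']
    · rw [inner_smul_left, conj_trivial]
      ring

/-- At the boundary point in direction `u`, the support value in the normal direction is `⟪X p, ν p⟫
≤ ‖X p‖`. A lower bound on the support function therefore passes to the radial function. -/
theorem exists_bodySupport_le {X : Sph d → Euc d} {ν : Sph d → Sph d} (hK : IsCompact K)
    (hc : Convex ℝ K) (h0 : (0 : Euc d) ∈ interior K) (hfr : frontier K = range X)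
    (hν : IsOuterNormal X ν) (u : Sph d) : ∃ x, bodySupport K x ≤ (gauge K u)⁻¹ := by
  obtain ⟨p, rfl⟩ := direction_surjective hK hc h0 hfr u
  have hz := ne_zero_of_range hc h0 hfr p
  have hn := norm_pos_iff.2 hz
  refine ⟨ν p, csSup_le ⟨_, mem_range_self p⟩ ?_⟩
  rintro _ ⟨v, rfl⟩
  dsimp only
  rw [coe_direction hz, gauge_pos_smul _ (by positivity), gauge_eq_one_of_range hc h0 hfr, mul_one,
    inv_inv, div_le_iff₀ (gauge_pos_of_ne hK h0 (sphere_ne_zero v))]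
  refine (inner_normal_le hK hc h0 hfr hν p v).trans
    (mul_le_mul_of_nonneg_right ?_ (gauge_nonneg _))
  have := real_inner_le_norm (X p) (ν p : Euc d)
  rwa [norm_sphere, mul_one] at this

theorem abs_inner_le_bodySupport_mul (hK : IsCompact K) (hc : Convex ℝ K)
    (h0 : (0 : Euc d) ∈ interior K) (hsymm : ∀ y, gauge K (-y) = gauge K y) (u x : Sph d) :
    |⟪(u : Euc d), (x : Euc d)⟫| ≤ bodySupport K x * gauge K u := by
  have hpos := gauge_pos_of_ne hK h0 (sphere_ne_zero u)
  have h1 := inner_div_gauge_le_bodySupport hK hc h0 u x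
  have h2 := inner_div_gauge_le_bodySupport hK hc h0 (-u) x
  rw [coe_neg_sphere, hsymm, inner_neg_left] at h2
  rw [div_le_iff₀ hpos] at h1 h2
  exact abs_le'.2 ⟨h1, h2⟩

theorem bodySupport_le_of_forall_gauge {R : ℝ} (hK : IsCompact K) (h0 : (0 : Euc d) ∈ interior K)
    (h : ∀ u : Sph d, (gauge K u)⁻¹ ≤ R) (x : Sph d) : bodySupport K x ≤ R := by
  refine csSup_le ⟨_, mem_range_self x⟩ ?_
  rintro _ ⟨u, rfl⟩
  refine le_trans ?_ (h u)
  dsimp only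
  rw [div_eq_mul_inv]
  exact mul_le_of_le_one_left (inv_pos.2 (gauge_pos_of_ne hK h0 (sphere_ne_zero u))).le
    ((le_abs_self _).trans (abs_inner_sphere_le_one u x))

end Estimates

end GaussFlow

end

theorem lemma3p2 (d : ℕ) (hd : 1 ≤ d)
    (f g : GaussFlow.Sph d → ℝ)
    (hf : ContMDiff (𝓡 d) 𝓘(ℝ, ℝ) ∞ f) (hg : ContMDiff (𝓡 d) 𝓘(ℝ, ℝ) ∞ g)
    (hf_pos : ∀ x, 0 < f x) (hg_pos : ∀ x, 0 < g x)
    (hf_even : ∀ x, f (-x) = f x) (hg_even : ∀ x, g (-x) = g x)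
    (hfg : ∫ x, f x ∂(GaussFlow.sphereMeasure d) = ∫ u, g u ∂(GaussFlow.sphereMeasure d))
    (M₀ : Set (GaussFlow.Euc d))
    (hM₀ : GaussFlow.IsUniformlyConvexHypersurface M₀)
    (hM₀_symm : ∀ y ∈ M₀, -y ∈ M₀) :
    ∃ C : ℝ, 0 < C ∧
      ∀ (T : EReal) (X : ℝ → GaussFlow.Sph d → GaussFlow.Euc d)
        (ν : ℝ → GaussFlow.Sph d → GaussFlow.Sph d),
        GaussFlow.IsStrictlyConvexSolution f g T X ν →
        range (X 0) = M₀ →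
        ∀ t ∈ GaussFlow.timeInterval T,
          (∀ x, 1 / C ≤ GaussFlow.supportFn (range (X t)) x ∧
            GaussFlow.supportFn (range (X t)) x ≤ C) ∧
          (∀ u, 1 / C ≤ GaussFlow.radialFn (range (X t)) u ∧
            GaussFlow.radialFn (range (X t)) u ≤ C) := by
  have hfc : Continuous f := hf.continuous
  have hgc : Continuous g := hg.continuous
  obtain ⟨L, hL⟩ := GaussFlow.exists_integral_neg_log_inner_le d
  have hbound : ∀ φ : GaussFlow.Sph d → ℝ, Continuous φ → ∃ M : ℝ, 0 ≤ M ∧ ∀ x, φ x ≤ M := by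
    intro φ hφ
    obtain ⟨M, hM⟩ := (isCompact_range hφ).bddAbove
    exact ⟨max M 0, le_max_right _ _, fun x => (hM (mem_range_self x)).trans (le_max_left _ _)⟩
  obtain ⟨Mf, hMf0, hMf⟩ := hbound f hfc
  obtain ⟨Mg, hMg0, hMg⟩ := hbound g hgc
  set I := ∫ x, f x ∂(GaussFlow.sphereMeasure d) with hI
  have hIpos : 0 < I := by
    rw [hI, integral_pos_iff_support_of_nonneg (fun x => (hf_pos x).le)
      (GaussFlow.integrable_of_continuous hfc)]
    have : Function.support f = univ := eq_univ_of_forall fun x => (hf_pos x).ne'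
    rw [this]
    exact Measure.measure_univ_pos.2 GaussFlow.sphereMeasure_ne_zero
  set A := ∫ u, g u * Real.log (GaussFlow.radialFn M₀ u)⁻¹ ∂(GaussFlow.sphereMeasure d) with hA
  set B := ∫ x, f x * Real.log (GaussFlow.supportFn M₀ x) ∂(GaussFlow.sphereMeasure d) with hB
  -- The first entry bounds `log ρ` above, the second bounds `-log h` above; both use `∫ f = ∫ g =
  -- I`. Only `M₀`, `f`, `g` and `d` enter.
  set γ := max ((B + Mf * L) / I) ((A + Mg * L) / I) with hγ
  refine ⟨Real.exp γ, Real.exp_pos _, fun T X ν hX hX0 t ht => ?_⟩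
  have hex : ∀ s, ∃ K : Set (GaussFlow.Euc d), s ∈ GaussFlow.timeInterval T →
      IsCompact K ∧ StrictConvex ℝ K ∧ 0 ∈ interior K ∧ frontier K = range (X s) := by
    intro s
    by_cases hs : s ∈ GaussFlow.timeInterval T
    · obtain ⟨K, hK⟩ := hX.strictlyConvex s hs
      exact ⟨K, fun _ => hK⟩
    · exact ⟨∅, fun h => absurd h hs⟩
  choose K hK using hex
  have hflow : GaussFlow.IsGaugeFlow f g T K :=
    GaussFlow.isGaugeFlow_of_solution hX hg_pos (fun s hs => (hK s hs).1)
      (fun s hs => (hK s hs).2.1) (fun s hs => (hK s hs).2.2.1) (fun s hs => (hK s hs).2.2.2)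
  have h0I : (0 : ℝ) ∈ GaussFlow.timeInterval T :=
    GaussFlow.Icc_subset_timeInterval ht ⟨le_rfl, ht.1⟩
  obtain ⟨hc0, hs0, hz0, hfr0⟩ := hK 0 h0I
  obtain ⟨hct, hst, hzt, hfrt⟩ := hK t ht
  rw [hX0] at hfr0
  have hA' : ∫ u, g u * Real.log (gauge (K 0) u) ∂(GaussFlow.sphereMeasure d) = A := by
    rw [hA, ← hfr0]
    simp_rw [GaussFlow.radialFn_frontier hc0 hs0.convex hz0, inv_inv]
  have hB' : ∫ x, f x * Real.log (GaussFlow.bodySupport (K 0) x) ∂(GaussFlow.sphereMeasure d) =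
      B := by
    rw [hB, ← hfr0]
    simp_rw [GaussFlow.supportFn_frontier hc0 hs0.convex hz0]
  have hsymm0 : ∀ u : GaussFlow.Sph d,
      gauge (K 0) (-(u : GaussFlow.Euc d)) = gauge (K 0) u := by
    intro u
    have h1 := GaussFlow.radialFn_frontier hc0 hs0.convex hz0 u
    have h2 := GaussFlow.radialFn_frontier hc0 hs0.convex hz0 (-u)
    rw [coe_neg_sphere] at h2
    have h3 : GaussFlow.radialFn (frontier (K 0)) (-u) = GaussFlow.radialFn (frontier (K 0)) u := by
      rw [hfr0, GaussFlow.radialFn, GaussFlow.radialFn]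
      congr 1
      ext r
      simp only [coe_neg_sphere, smul_neg, mem_ofPred_eq]
      refine and_congr_right fun _ => ⟨fun h => ?_, fun h => hM₀_symm _ h⟩
      simpa using hM₀_symm _ h
    rw [h1, h2] at h3
    exact inv_injective h3
  have hsymm := hflow.gauge_neg hf_pos hg_pos hf_even hg_even hsymm0 ht
  have hAt := hflow.integral_log_gauge_eq hfc hgc hg_pos hfg ht
  have hBt := hflow.integral_log_bodySupport_le hfc hf_pos hgc hg_pos hfg ht
  rw [hA'] at hAt
  rw [hB'] at hBt
  have hJpos := hflow.gauge_pos ht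
  have hHpos := hflow.bodySupport_pos ht
  have hinner := GaussFlow.abs_inner_le_bodySupport_mul hct hst.convex hzt hsymm
  -- Fix `u`, integrate `log |⟪x, u⟫| ≤ log h x + log j u` against `f` in `x`, and use that the
  -- support integral has not increased.
  have hρ : ∀ u : GaussFlow.Sph d, (gauge (K t) u)⁻¹ ≤ Real.exp γ := by
    intro u
    have h1 := GaussFlow.mul_integral_sub_le_of_log_inner_le (hL u).1 (hL u).2 hfc
      (hflow.continuous_log_bodySupport ht) hf_pos hMf0 hMf (s := -Real.log (gauge (K t) u))
      (fun x hx => by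
        have h2 := hinner u x
        rw [real_inner_comm] at h2
        have h3 := Real.log_le_log (abs_pos.2 hx) h2
        rw [Real.log_mul (hHpos x).ne' (hJpos u).ne'] at h3
        linarith)
    rw [← Real.log_le_iff_le_exp (inv_pos.2 (hJpos u)), Real.log_inv]
    refine le_trans ?_ (le_max_left _ _)
    rw [le_div_iff₀ hIpos]
    linarith
  -- The same inequality with `x` fixed, integrated against `g` in `u`, using the conserved
  -- integral.
  have hh : ∀ x : GaussFlow.Sph d, Real.exp (-γ) ≤ GaussFlow.bodySupport (K t) x := by
    intro x
    have h1 := GaussFlow.mul_integral_sub_le_of_log_inner_le (hL x).1 (hL x).2 hgc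
      (hflow.continuous_log_gauge ht) hg_pos hMg0 hMg
      (s := -Real.log (GaussFlow.bodySupport (K t) x))
      (fun u hu => by
        have h3 := Real.log_le_log (abs_pos.2 hu) (hinner u x)
        rw [Real.log_mul (hHpos x).ne' (hJpos u).ne'] at h3
        linarith)
    rw [← Real.le_log_iff_exp_le (hHpos x), neg_le]
    refine le_trans ?_ (le_max_right _ _)
    rw [le_div_iff₀ hIpos]
    rw [← hfg] at h1
    linarith
  rw [one_div, ← Real.exp_neg, ← hfrt]
  refine ⟨fun x => ?_, fun u => ?_⟩
  · rw [GaussFlow.supportFn_frontier hct hst.convex hzt]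
    exact ⟨hh x, GaussFlow.bodySupport_le_of_forall_gauge hct hzt hρ x⟩
  · rw [GaussFlow.radialFn_frontier hct hst.convex hzt]
    obtain ⟨x, hx⟩ := GaussFlow.exists_bodySupport_le hct hst.convex hzt hfrt (hX.normal t ht) u
    exact ⟨(hh x).trans hx, hρ u⟩
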